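/- Let $\mathsf{M}\colon\mathbb{N}\to\mathbb{N}$ be a multiplication time for polynomials over a field $\mathbb{F}$: for every $n\ge 1$, two polynomials of degree less than $n$ in $\mathbb{F}[x]$ can be multiplied using at most $\mathsf{M}(n)$ operations in $\mathbb{F}$, and $\mathsf{M}$ is super-linear, i.e. $\mathsf{M}(n)\ge n$ and $\mathsf{M}(m+n)\ge\mathsf{M}(m)+\mathsf{M}(n)$ for all $m,n\ge 1$. Algorithms are algebraic computation trees over $\mathbb{F}$; each operation $+,-,\times,\div$ and each zero test counts as one operation, constants of $\mathbb{F}$ are free, and division by zero is not allowed. Let $d\ge 0$ and $\mu\ge 1$ be integers such that $\mathbb{F}$ has characteristic $0$ or at least $\mu$. For a monic separable polynomial $T\in\mathbb{F}[x]$ of degree $d$, let $\mathbb{K}=\mathbb{F}[y]/\langle T(y)\rangle$, let $\alpha$ be the residue class of $y$ in $\mathbb{K}$, and let $$\pi_{T,\mu}\colon \mathbb{F}[x]/\langle T^\mu\rangle\to\mathbb{K}[\xi]/\langle\xi^\mu\rangle,\qquad x\mapsto\xi+\alpha,$$ be the untangling isomorphism of $\mathbb{F}$-algebras. Then, given the coefficients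 of such a $T$ and an element $G=\sum_{i<d,\,j<\mu}g_{i,j}\,\alpha^i\xi^j$ of $\mathbb{K}[\xi]/\langle\xi^\mu\rangle$ by its coefficients $g_{i,j}\in\mathbb{F}$, one can compute ${\pi_{T,\mu}}^{-1}(G)$ (tangling), given by its coefficients on the basis $1,x,\dots,x^{d\mu-1}$, in $$O\bigl(\mathsf{M}(d\mu)\log(\mu)+\mathsf{M}(d)\log(d)\bigr)$$ operations in $\mathbb{F}$, where the constant in the $O(\cdot)$ is absolute, i.e. independent of $\mathbb{F}$, $\mathsf{M}$, $d$, $\mu$, $T$ and $G$, and $\log 0$ is read as $0$. -/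

import Mathlib

open Polynomial

universe u

noncomputable section

/-! ### Untangling and tangling -/

/-- `K = F[y] / ⟨T(y)⟩`; the residue class `α` of `y` is `AdjoinRoot.root T`. -/
abbrev ResidueAlg {F : Type u} [Field F] (T : F[X]) : Type u := AdjoinRoot T

/-- `F[x] / ⟨T ^ μ⟩`. -/
abbrev PowerAlg {F : Type u} [Field F] (T : F[X]) (μ : ℕ) : Type u := AdjoinRoot (T ^ μ)

/-- `K[ξ] / ⟨ξ ^ μ⟩`, where `K = F[y] / ⟨T(y)⟩`. -/
abbrev TruncAlg {F : Type u} [Field F] (T : F[X]) (μ : ℕ) : Type u :=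
  AdjoinRoot ((X : (ResidueAlg T)[X]) ^ μ)

/-- The class of `ξ` in `K[ξ] / ⟨ξ ^ μ⟩`. -/
def TruncAlg.xi {F : Type u} [Field F] (T : F[X]) (μ : ℕ) : TruncAlg T μ :=
  AdjoinRoot.root _

/-- The image of `α ∈ K` in `K[ξ] / ⟨ξ ^ μ⟩`. -/
def TruncAlg.alpha {F : Type u} [Field F] (T : F[X]) (μ : ℕ) : TruncAlg T μ :=
  AdjoinRoot.of _ (AdjoinRoot.root T)

theorem TruncAlg.aeval_xi_add_alpha {F : Type u} [Field F] (T : F[X]) (μ : ℕ) (P : F[X]) :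
    aeval (TruncAlg.xi T μ + TruncAlg.alpha T μ) P =
      AdjoinRoot.mk _ ((P.map (AdjoinRoot.of T)).comp (X + C (AdjoinRoot.root T))) := by
  rw [Polynomial.comp, Polynomial.eval₂_map, Polynomial.hom_eval₂, Polynomial.aeval_def]
  congr 1

theorem TruncAlg.aeval_eq_zero_iff {F : Type u} [Field F] (T : F[X]) (μ : ℕ) (P : F[X]) :
    aeval (TruncAlg.xi T μ + TruncAlg.alpha T μ) P = 0 ↔
      (X - C (AdjoinRoot.root T)) ^ μ ∣ P.map (AdjoinRoot.of T) := by
  rw [TruncAlg.aeval_xi_add_alpha, AdjoinRoot.mk_eq_zero, Polynomial.dvd_comp_X_add_C_iff]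
  simp

theorem TruncAlg.aeval_pow_eq_zero {F : Type u} [Field F] (T : F[X]) (μ : ℕ) :
    aeval (TruncAlg.xi T μ + TruncAlg.alpha T μ) (T ^ μ) = 0 := by
  rw [TruncAlg.aeval_eq_zero_iff, Polynomial.map_pow]
  exact pow_dvd_pow_of_dvd (dvd_iff_isRoot.mpr (AdjoinRoot.isRoot_root T)) μ

/-- Untangling, as an `F`-algebra homomorphism: `x ↦ ξ + α`. -/
def untanglingHom {F : Type u} [Field F] (T : F[X]) (μ : ℕ) :
    PowerAlg T μ →ₐ[F] TruncAlg T μ :=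
  AdjoinRoot.liftAlgHom (T ^ μ) (Algebra.ofId F (TruncAlg T μ))
    (TruncAlg.xi T μ + TruncAlg.alpha T μ) (TruncAlg.aeval_pow_eq_zero T μ)

theorem pow_dvd_of_sub_root_pow_dvd {F : Type u} [Field F] {T : F[X]} (hT : T.Separable)
    (P : F[X]) (μ : ℕ)
    (h : (X - C (AdjoinRoot.root T)) ^ μ ∣ P.map (AdjoinRoot.of T)) : T ^ μ ∣ P := by
  induction μ with
  | zero => simp
  | succ m ih =>
    obtain ⟨H, rfl⟩ := ih ((pow_dvd_pow _ m.le_succ).trans h)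
    obtain ⟨U, hU⟩ := dvd_iff_isRoot.mpr (AdjoinRoot.isRoot_root T)
    -- `U(α) = T'(α)` is a unit
    have hunit : IsUnit (U.eval (AdjoinRoot.root T)) := by
      have h1 : (derivative (T.map (AdjoinRoot.of T))).eval (AdjoinRoot.root T) =
          U.eval (AdjoinRoot.root T) := by
        rw [hU]; simp [derivative_mul]
      obtain ⟨a, b, hab⟩ := hT
      have h2 := congrArg (AdjoinRoot.mk T) hab
      rw [map_add, map_mul, map_mul, AdjoinRoot.mk_self, mul_zero, zero_add, map_one] at h2
      rw [← h1, derivative_map, eval_map, ← AdjoinRoot.algebraMap_eq, ← aeval_def,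
        AdjoinRoot.aeval_eq]
      exact IsUnit.of_mul_eq_one _ (by rw [mul_comm]; exact h2)
    rw [Polynomial.map_mul, Polynomial.map_pow, hU, mul_pow, mul_assoc, pow_succ] at h
    have h3 := (((monic_X_sub_C (AdjoinRoot.root T)).pow m).isRegular.left).dvd_cancel_left.mp h
    rw [dvd_iff_isRoot, IsRoot.def, eval_mul, eval_pow, (hunit.pow m).mul_right_eq_zero, eval_map,
      ← AdjoinRoot.algebraMap_eq, ← aeval_def, AdjoinRoot.aeval_eq, AdjoinRoot.mk_eq_zero] at h3
    rw [pow_succ]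
    exact mul_dvd_mul_left _ h3

theorem untanglingHom_bijective {F : Type u} [Field F] {T : F[X]} (hT : T.Separable) (μ : ℕ) :
    Function.Bijective (untanglingHom T μ) := by
  have hinj : Function.Injective (untanglingHom T μ) := by
    rw [injective_iff_map_eq_zero]
    intro a
    induction a using AdjoinRoot.induction_on with
    | ih p =>
      intro hp
      rw [AdjoinRoot.mk_eq_zero]
      exact pow_dvd_of_sub_root_pow_dvd hT p μ ((TruncAlg.aeval_eq_zero_iff T μ p).mp hp)
  refine ⟨hinj, ?_⟩
  have h0 : T ≠ 0 := hT.ne_zero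
  rcases subsingleton_or_nontrivial (ResidueAlg T) with hs | hn
  · have : Subsingleton (TruncAlg T μ) := by
      refine subsingleton_of_zero_eq_one ?_
      have := congrArg (AdjoinRoot.of ((X : (ResidueAlg T)[X]) ^ μ)) (Subsingleton.elim 0 1)
      simpa using this
    exact fun b => ⟨0, Subsingleton.elim _ _⟩
  · have hm : ((X : (ResidueAlg T)[X]) ^ μ).Monic := monic_X_pow μ
    have : Module.Finite F (ResidueAlg T) := (AdjoinRoot.powerBasis h0).finite
    have : Module.Finite (ResidueAlg T) (TruncAlg T μ) := hm.finite_adjoinRoot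
    have : Module.Free (ResidueAlg T) (TruncAlg T μ) := hm.free_adjoinRoot
    have : Module.Finite F (PowerAlg T μ) := (AdjoinRoot.powerBasis (pow_ne_zero μ h0)).finite
    have : Module.Finite F (TruncAlg T μ) := Module.Finite.trans (ResidueAlg T) _
    have e1 : Module.finrank F (PowerAlg T μ) = μ * T.natDegree := by
      rw [(AdjoinRoot.powerBasis (pow_ne_zero μ h0)).finrank, AdjoinRoot.powerBasis_dim,
        natDegree_pow]
    have e2 : Module.finrank F (TruncAlg T μ) = T.natDegree * μ := by
      rw [← Module.finrank_mul_finrank F (ResidueAlg T) (TruncAlg T μ),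
        (AdjoinRoot.powerBasis h0).finrank, AdjoinRoot.powerBasis_dim,
        (AdjoinRoot.powerBasis' hm).finrank, AdjoinRoot.powerBasis'_dim, natDegree_X_pow]
    exact ((LinearMap.injective_iff_surjective_of_finrank_eq_finrank
      (f := (untanglingHom T μ).toLinearMap) (by rw [e1, e2, mul_comm])).mp hinj)

/-- The untangling isomorphism `F[x] / ⟨T ^ μ⟩ ≃ K[ξ] / ⟨ξ ^ μ⟩`, `x ↦ ξ + α`. -/
def untangling {F : Type u} [Field F] (T : F[X]) (hT : T.Separable) (μ : ℕ) :
    PowerAlg T μ ≃ₐ[F] TruncAlg T μ :=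
  AlgEquiv.ofBijective (untanglingHom T μ) (untanglingHom_bijective hT μ)

/-- Tangling: the inverse of untangling. -/
def tangling {F : Type u} [Field F] (T : F[X]) (hT : T.Separable) (μ : ℕ) :
    TruncAlg T μ ≃ₐ[F] PowerAlg T μ :=
  (untangling T hT μ).symm

/-- The polynomial `∑ i < n, a i * x ^ i` with coefficient vector `a`. -/
def polyOfCoeffs {F : Type u} [Field F] {n : ℕ} (a : Fin n → F) : F[X] :=
  ∑ i : Fin n, C (a i) * X ^ (i : ℕ)

/-- The element `∑ g (i, j) * α ^ i * ξ ^ j` (`i < d`, `j < μ`) of `K[ξ] / ⟨ξ ^ μ⟩`. When `T` is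
monic of degree `d`, every element is of this form for exactly one `g`. -/
def TruncAlg.ofCoeffs {F : Type u} [Field F] (T : F[X]) {d μ : ℕ} (g : Fin d × Fin μ → F) :
    TruncAlg T μ :=
  ∑ p : Fin d × Fin μ, g p • (TruncAlg.alpha T μ ^ (p.1 : ℕ) * TruncAlg.xi T μ ^ (p.2 : ℕ))

/-! ### Algebraic computation trees over a field -/

/-- The four arithmetic operations. -/
inductive ArithOp : Type
  | add | sub | mul | div

/-- The result of an operation; a division by zero is undefined. -/
def ArithOp.eval {F : Type u} [Field F] : ArithOp → F → F → Option F
  | .add, a, b => some (a + b)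
  | .sub, a, b => some (a - b)
  | .mul, a, b => some (a * b)
  | .div, a, b => open Classical in if b = 0 then none else some (a / b)

/-- Algebraic computation trees over `F` with outputs indexed by `ι`. A tree of type
`CompTree F ι V` has access to one field element for each `v : V` (the inputs and the values
obtained so far); an instruction that produces a new value makes it available as `none` in
`Option V`, the old values being `some v`. The shape of a tree does not depend on the values of
its inputs other than through its zero tests.
* `ret out`: stop, and return the values designated by `out`;
* `const c t`: make the constant `c` available, and go on with `t`;
* `op o v w t`: apply the operation `o` to the values `v` and `w`, and go on with `t`;
* `ifZero v t e`: go on with `t` if the value `v` is zero, and with `e` otherwise. -/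
inductive CompTree (F : Type u) (ι : Type) : Type → Type (max u 1)
  | ret {V : Type} (out : ι → V) : CompTree F ι V
  | const {V : Type} (c : F) (t : CompTree F ι (Option V)) : CompTree F ι V
  | op {V : Type} (o : ArithOp) (v w : V) (t : CompTree F ι (Option V)) : CompTree F ι V
  | ifZero {V : Type} (v : V) (t e : CompTree F ι V) : CompTree F ι V

/-- Run a tree on the values `ρ`: the returned outputs, and the number of arithmetic operations and
zero tests executed (each counts one; constants are free). The result is `none` if a division by
zero is met. -/
def CompTree.run {F : Type u} [Field F] {ι : Type} :
    {V : Type} → CompTree F ι V → (V → F) → Option ((ι → F) × ℕ)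
  | _, .ret out, ρ => some (fun i => ρ (out i), 0)
  | _, .const c t, ρ => t.run (fun v => v.elim c ρ)
  | _, .op o v w t, ρ =>
      (o.eval (ρ v) (ρ w)).bind fun a =>
        (t.run (fun v => v.elim a ρ)).map fun r => (r.1, r.2 + 1)
  | _, .ifZero v t e, ρ =>
      open Classical in
      (if ρ v = 0 then t.run ρ else e.run ρ).map fun r => (r.1, r.2 + 1)

/-- On the input `ρ`, the tree `t` returns `y` after at most `B` operations, and no division by zero
occurs. -/
def CompTree.Computes {F : Type u} [Field F] {ι V : Type} (t : CompTree F ι V) (ρ : V → F)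
    (y : ι → F) (B : ℝ) : Prop :=
  ∃ k : ℕ, t.run ρ = some (y, k) ∧ (k : ℝ) ≤ B

/-- `M` is a multiplication time for `F[x]`: the product of two polynomials of degree less than `n`
can be computed in `M n` operations, and `M` is super-linear. -/
structure IsMultiplicationTime (F : Type u) [Field F] (M : ℕ → ℕ) : Prop where
  /-- For each `n ≥ 1` a computation tree multiplies in at most `M n` operations. -/
  exists_mul : ∀ n : ℕ, 0 < n → ∃ P : CompTree F (Fin (2 * n - 1)) (Fin n ⊕ Fin n),
    ∀ a b : Fin n → F,
      P.Computes (Sum.elim a b) (fun k => (polyOfCoeffs a * polyOfCoeffs b).coeff k) (M n)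
  le_self : ∀ n : ℕ, 0 < n → n ≤ M n
  add_le : ∀ m n : ℕ, 0 < m → 0 < n → M m + M n ≤ M (m + n)

end

/-! Write `G = ∑ c_j(α) ξ^j`, and `T = (x - α) U` over `K`; separability makes `U(α) = T'(α)` a
unit. For a polynomial `P`, the fraction `P / T` is `(P(α) / U(α)) / (x - α)` plus a part regular at
`α`, so `(-1)^k` times its `k`-th derivative has principal part `k! (P(α) / U(α)) / (x - α)^(k+1)`.
Take `P = c_(μ-1-k) / k!`, which the assumption on the characteristic allows, sum over `k < μ` and
multiply by `T^μ`: the resulting polynomial `N(G)` untangles to `w G`, where `w`, the class of `U^μ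
/ U(α)`, does not depend on `G` (`untanglingHom_derivSum`). Hence the tangling of `G` is `N(G) /
N(1)` modulo `T^μ` (`mk_eq_tangling`); the division is possible because `N(1)` is `T'^(μ-1)` modulo
`T` (`isCoprime_derivSum_one`).

`N(G)` is computed by divide and conquer on the order of the derivatives (`derivSum_add`). High
derivatives of a fraction are taken on its expansion at infinity, where differentiation multiplies
each coefficient by a constant (`derivNumIter_eq_highPart`). Each level of the recursion costs
`O(M(dμ))` (`reach_derivSum`). `N(1)` is inverted modulo `T` only, in `O(M(d) (log d + 1))`
(`reach_inverse_mod`), and the inverse is lifted to `T^μ` by about `log μ` Newton steps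
(`reach_lift`). The inversion is a half-gcd on Bernstein-Yang division steps, whose number and sizes
do not depend on the data (`trans_initState_bezout`, `TransCost.add`).

No tree is written out: costs are established for `Reach`, which composes additively (`Reach.bind`),
and the tree is extracted once at the end (`exists_compTree_of_reach`). -/

/-! ### Reachability: a cost-aware weakest precondition for computation trees -/

/-- A node of a computation tree: the inputs that lead to it, and the values known there, as
functions of the input. -/
structure Stage (Ω F : Type u) where
  inputs : Set Ω
  known : Set (Ω → F)

namespace Stage

variable {F Ω : Type u}

/-- `s.Later s'`: the node `s'` is below the node `s`. -/
def Later (s s' : Stage Ω F) : Prop := s'.inputs ⊆ s.inputs ∧ s.known ⊆ s'.known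

theorem Later.refl (s : Stage Ω F) : s.Later s := ⟨subset_rfl, subset_rfl⟩

theorem Later.trans {s t r : Stage Ω F} (h : s.Later t) (h' : t.Later r) : s.Later r :=
  ⟨h'.1.trans h.1, h.2.trans h'.2⟩

/-- The node after a value `w` has been made available. -/
def learn (s : Stage Ω F) (w : Ω → F) : Stage Ω F := ⟨s.inputs, insert w s.known⟩

/-- The node after a test has left only the inputs in `A`. -/
def restrict (s : Stage Ω F) (A : Set Ω) : Stage Ω F := ⟨s.inputs ∩ A, s.known⟩

theorem later_learn (s : Stage Ω F) (w : Ω → F) : s.Later (s.learn w) :=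
  ⟨subset_rfl, Set.subset_insert _ _⟩

theorem later_restrict (s : Stage Ω F) (A : Set Ω) : s.Later (s.restrict A) :=
  ⟨Set.inter_subset_left, subset_rfl⟩

/-- The value `v` is available at `s` (constants always are). -/
def Has (s : Stage Ω F) (v : Ω → F) : Prop :=
  (∃ a ∈ s.known, ∀ ω ∈ s.inputs, a ω = v ω) ∨ ∃ c, ∀ ω ∈ s.inputs, v ω = c

theorem Has.mono {s s' : Stage Ω F} {v : Ω → F} (h : s.Has v) (hs : s.Later s') : s'.Has v := by
  rcases h with ⟨a, ha, h⟩ | ⟨c, h⟩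
  · exact .inl ⟨a, hs.2 ha, fun ω hω => h ω (hs.1 hω)⟩
  · exact .inr ⟨c, fun ω hω => h ω (hs.1 hω)⟩

theorem Has.congr {s : Stage Ω F} {v w : Ω → F} (h : s.Has v) (hv : ∀ ω ∈ s.inputs, v ω = w ω) :
    s.Has w := by
  rcases h with ⟨a, ha, h⟩ | ⟨c, h⟩
  · exact .inl ⟨a, ha, fun ω hω => (h ω hω).trans (hv ω hω)⟩
  · exact .inr ⟨c, fun ω hω => (hv ω hω).symm.trans (h ω hω)⟩

theorem has_const (s : Stage Ω F) (c : F) : s.Has fun _ => c := .inr ⟨c, fun _ _ => rfl⟩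

theorem has_learn (s : Stage Ω F) (v : Ω → F) : (s.learn v).Has v :=
  .inl ⟨v, Set.mem_insert _ _, fun _ _ => rfl⟩

variable [Field F]

/-- `Reach Q n s`: from the node `s`, a computation tree reaches only nodes satisfying `Q`, with at
most `n` operations on each path. -/
inductive Reach (Q : Stage Ω F → Prop) : ℕ → Stage Ω F → Prop
  | done {n : ℕ} {s : Stage Ω F} (h : Q s) : Reach Q n s
  | vacuous {n : ℕ} {s : Stage Ω F} (h : s.inputs = ∅) : Reach Q n s
  | const {n : ℕ} {s : Stage Ω F} (c : F) (h : Reach Q n (s.learn fun _ => c)) : Reach Q n s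
  | op {n : ℕ} {s : Stage Ω F} (o : ArithOp) (a b w : Ω → F) (ha : a ∈ s.known)
      (hb : b ∈ s.known) (hw : ∀ ω ∈ s.inputs, o.eval (a ω) (b ω) = some (w ω))
      (h : Reach Q n (s.learn w)) : Reach Q (n + 1) s
  | test {n : ℕ} {s : Stage Ω F} (a : Ω → F) (ha : a ∈ s.known)
      (h0 : Reach Q n (s.restrict {ω | a ω = 0})) (h1 : Reach Q n (s.restrict {ω | a ω ≠ 0})) :
      Reach Q (n + 1) s

theorem Reach.weaken {Q : Stage Ω F → Prop} {n : ℕ} {s : Stage Ω F} (h : Reach Q n s) (k : ℕ)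
    (hk : n ≤ k) : Reach Q k s := by
  induction h generalizing k with
  | done h => exact .done h
  | vacuous h => exact .vacuous h
  | const c _ ih => exact .const c (ih k hk)
  | op o a b w ha hb hw _ ih =>
    obtain ⟨k, rfl⟩ : ∃ l, k = l + 1 := ⟨k - 1, by omega⟩
    exact .op o a b w ha hb hw (ih k (by omega))
  | test a ha _ _ ih0 ih1 =>
    obtain ⟨k, rfl⟩ : ∃ l, k = l + 1 := ⟨k - 1, by omega⟩
    exact .test a ha (ih0 k (by omega)) (ih1 k (by omega))

/-- Sequential composition: the second computation is grafted at every leaf of the first, and the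
costs add. That each leaf is `Later` than `s` is what carries earlier available values along. -/
theorem Reach.bind {P Q : Stage Ω F → Prop} {n m : ℕ} {s : Stage Ω F} (h : Reach P n s) (k : ℕ)
    (hk : n + m ≤ k) (hQ : ∀ s', s.Later s' → P s' → Reach Q m s') : Reach Q k s := by
  refine Reach.weaken (n := n + m) ?_ k hk
  clear hk
  induction h with
  | done h => exact (hQ _ (Later.refl _) h).weaken _ (Nat.le_add_left ..)
  | vacuous h => exact .vacuous h
  | const c _ ih => exact .const c (ih fun s' h => hQ s' ((later_learn _ _).trans h))
  | op o a b w ha hb hw _ ih =>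
    rw [Nat.add_right_comm]
    exact .op o a b w ha hb hw (ih fun s' h => hQ s' ((later_learn _ _).trans h))
  | test a ha _ _ ih0 ih1 =>
    rw [Nat.add_right_comm]
    exact .test a ha (ih0 fun s' h => hQ s' ((later_restrict _ _).trans h))
      (ih1 fun s' h => hQ s' ((later_restrict _ _).trans h))

theorem Reach.mono {P Q : Stage Ω F → Prop} {n : ℕ} {s : Stage Ω F} (h : Reach P n s) {k : ℕ}
    (hk : n ≤ k) (hQ : ∀ s', s.Later s' → P s' → Q s') : Reach Q k s :=
  h.bind (m := 0) k hk fun s' h h' => .done (hQ s' h h')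

/-- Passing from an available value to a known function is free: either a known function already
agrees with it on the inputs, or it is constant there and a `const` instruction supplies it. -/
theorem Reach.ofKnown {Q : Stage Ω F → Prop} {n : ℕ} {s : Stage Ω F} {v : Ω → F} (hv : s.Has v)
    (h : ∀ s', s.Later s' → s'.inputs = s.inputs → ∀ a ∈ s'.known,
      (∀ ω ∈ s.inputs, a ω = v ω) → Reach Q n s') : Reach Q n s := by
  rcases hv with ⟨a, ha, hav⟩ | ⟨c, hc⟩
  · exact h s (Later.refl s) rfl a ha hav
  · exact .const c (h _ (later_learn _ _) rfl _ (Set.mem_insert _ _) fun ω hω => (hc ω hω).symm)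

theorem reach_op (s : Stage Ω F) (o : ArithOp) {a b w : Ω → F} (ha : s.Has a) (hb : s.Has b)
    (hw : ∀ ω ∈ s.inputs, o.eval (a ω) (b ω) = some (w ω)) : Reach (fun s' => s'.Has w) 1 s := by
  refine Reach.ofKnown ha fun s₁ h₁ e₁ a' ha' haa => ?_
  refine Reach.ofKnown (hb.mono h₁) fun s₂ h₂ e₂ b' hb' hbb => ?_
  refine .op o a' b' w (h₂.2 ha') hb' ?_ (.done (has_learn _ _))
  intro ω hω
  rw [e₂] at hω
  rw [hbb ω hω]
  rw [e₁] at hω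
  rw [haa ω hω, hw ω hω]

theorem reach_add (s : Stage Ω F) {a b : Ω → F} (ha : s.Has a) (hb : s.Has b) :
    Reach (fun s' => s'.Has fun ω => a ω + b ω) 1 s :=
  s.reach_op .add ha hb fun _ _ => rfl

theorem reach_sub (s : Stage Ω F) {a b : Ω → F} (ha : s.Has a) (hb : s.Has b) :
    Reach (fun s' => s'.Has fun ω => a ω - b ω) 1 s :=
  s.reach_op .sub ha hb fun _ _ => rfl

theorem reach_mul (s : Stage Ω F) {a b : Ω → F} (ha : s.Has a) (hb : s.Has b) :
    Reach (fun s' => s'.Has fun ω => a ω * b ω) 1 s :=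
  s.reach_op .mul ha hb fun _ _ => rfl

theorem reach_div (s : Stage Ω F) {a b : Ω → F} (ha : s.Has a) (hb : s.Has b)
    (h0 : ∀ ω ∈ s.inputs, b ω ≠ 0) : Reach (fun s' => s'.Has fun ω => a ω / b ω) 1 s :=
  s.reach_op .div ha hb fun ω hω => by simp [ArithOp.eval, h0 ω hω]

/-- Below the test, the answer is the same for all inputs of the node, so that definitions by cases
become uniform there. -/
theorem reach_test (s : Stage Ω F) {a : Ω → F} (ha : s.Has a) :
    Reach (fun s' => (∀ ω ∈ s'.inputs, a ω = 0) ∨ ∀ ω ∈ s'.inputs, a ω ≠ 0) 1 s := by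
  refine Reach.ofKnown ha fun s₁ h₁ e₁ a' ha' haa => ?_
  refine .test a' ha' (.done (.inl fun ω hω => ?_)) (.done (.inr fun ω hω => ?_))
  · rw [← haa ω (e₁ ▸ hω.1)]; exact hω.2
  · rw [← haa ω (e₁ ▸ hω.1)]; exact hω.2

/-- Doing `m` computations one after the other. -/
theorem reach_forall (s : Stage Ω F) (c : ℕ) (P : ℕ → Stage Ω F → Prop)
    (hP : ∀ i s₁ s₂, s₁.Later s₂ → P i s₁ → P i s₂) (m : ℕ)
    (h : ∀ i < m, ∀ s', s.Later s' → Reach (P i) c s') :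
    Reach (fun s' => ∀ i < m, P i s') (m * c) s := by
  induction m with
  | zero => exact .done (by simp)
  | succ m ih =>
    refine (ih fun i hi => h i (hi.trans m.lt_succ_self)).bind (m := c) _ (by rw [Nat.succ_mul])
      fun s₁ h₁ H₁ => ?_
    refine (h m m.lt_succ_self s₁ h₁).mono le_rfl fun s₂ h₂ H₂ i hi => ?_
    rcases Nat.lt_succ_iff_lt_or_eq.mp hi with hi | rfl
    · exact hP i _ _ h₂ (H₁ i hi)
    · exact H₂

/-! ### Computation trees and reachability -/

/-- Each constructor of `Reach` is one instruction, so the tree is read off the derivation, before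
any input is chosen. The map `ρ` records which slot of the tree holds each known function. -/
theorem exists_compTree_of_reach {ι : Type} (Y : Ω → (ι → F) → Prop) {Q : Stage Ω F → Prop}
    (hQ : ∀ s, Q s → ∃ out : ι → Ω → F, (∀ i, out i ∈ s.known) ∧
      ∀ ω ∈ s.inputs, Y ω fun i => out i ω)
    {n : ℕ} {s : Stage Ω F} (h : Reach Q n s) {V : Type} (ρ : V → Ω → F)
    (hρ : ∀ a ∈ s.known, ∃ v, ρ v = a) :
    ∃ t : CompTree F ι V, ∀ ω ∈ s.inputs, ∃ y k, t.run (fun v => ρ v ω) = some (y, k) ∧ k ≤ n ∧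
      Y ω y := by
  have ext : ∀ {V : Type} (ρ : V → Ω → F) (s : Stage Ω F) (w : Ω → F),
      (∀ a ∈ s.known, ∃ v, ρ v = a) →
      ∀ a ∈ (s.learn w).known, ∃ v : Option V, (fun ω => v.elim (w ω) fun v => ρ v ω) = a := by
    intro V ρ s w hρ a ha
    rcases ha with rfl | ha
    · exact ⟨none, rfl⟩
    · obtain ⟨v, rfl⟩ := hρ a ha
      exact ⟨some v, rfl⟩
  induction h generalizing V with
  | done h =>
    obtain ⟨out, h1, h2⟩ := hQ _ h
    choose v hv using fun i => hρ _ (h1 i)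
    refine ⟨.ret v, fun ω hω => ⟨_, 0, rfl, Nat.zero_le _, ?_⟩⟩
    simpa [hv] using h2 ω hω
  | @vacuous n s h =>
    -- `V` may be empty, so a constant is created to give `ret` something to designate.
    refine ⟨.const 0 (.ret fun _ => none), fun ω hω => ?_⟩
    rw [h] at hω
    exact hω.elim
  | const c _ ih =>
    obtain ⟨t, ht⟩ := ih _ (ext ρ _ _ hρ)
    exact ⟨.const c t, fun ω hω => by
      obtain ⟨y, k, h1, h2⟩ := ht ω hω
      exact ⟨y, k, by rw [CompTree.run, ← h1], h2⟩⟩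
  | op o a b w ha hb hw _ ih =>
    obtain ⟨v, rfl⟩ := hρ a ha
    obtain ⟨v', rfl⟩ := hρ b hb
    obtain ⟨t, ht⟩ := ih _ (ext ρ _ _ hρ)
    refine ⟨.op o v v' t, fun ω hω => ?_⟩
    obtain ⟨y, k, h1, h2, h3⟩ := ht ω hω
    refine ⟨y, k + 1, ?_, by omega, h3⟩
    rw [CompTree.run, hw ω hω]
    simp only [Option.bind_some]
    rw [h1]
    rfl
  | test a ha _ _ ih0 ih1 =>
    obtain ⟨v, rfl⟩ := hρ a ha
    obtain ⟨t0, ht0⟩ := ih0 ρ hρ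
    obtain ⟨t1, ht1⟩ := ih1 ρ hρ
    refine ⟨.ifZero v t0 t1, fun ω hω => ?_⟩
    by_cases h : ρ v ω = 0
    · obtain ⟨y, k, h1, h2, h3⟩ := ht0 ω ⟨hω, h⟩
      exact ⟨y, k + 1, by rw [CompTree.run, if_pos h, h1]; rfl, by omega, h3⟩
    · obtain ⟨y, k, h1, h2, h3⟩ := ht1 ω ⟨hω, h⟩
      exact ⟨y, k + 1, by rw [CompTree.run, if_neg h, h1]; rfl, by omega, h3⟩

/-- The tree `t` can be run on available values. -/
theorem reach_run {ι V : Type} (t : CompTree F ι V) (ρ : V → Ω → F) (n : ℕ) (s : Stage Ω F)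
    (hρ : ∀ v, ρ v ∈ s.known)
    (ht : ∀ ω ∈ s.inputs, ∃ y k, t.run (fun v => ρ v ω) = some (y, k) ∧ k ≤ n) :
    Reach (fun s' => ∃ out : ι → Ω → F, (∀ i, s'.Has (out i)) ∧
      ∀ ω ∈ s'.inputs, ∃ k, t.run (fun v => ρ v ω) = some (fun i => out i ω, k)) n s := by
  induction t generalizing n s with
  | ret out =>
    exact .done ⟨fun i => ρ (out i), fun i => .inl ⟨_, hρ _, fun _ _ => rfl⟩,
      fun ω _ => ⟨0, rfl⟩⟩
  | const c t ih =>
    have := ih (fun v ω => v.elim c fun v => ρ v ω) n (s.learn fun _ => c) ?_ ht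
    · exact .const c this
    · rintro (_ | v)
      · exact Set.mem_insert _ _
      · exact Set.mem_insert_of_mem _ (hρ v)
  | op o v w t ih =>
    -- Without inputs `ht` says nothing about `n`, which may then be `0`; with one, `n` is positive.
    rcases Set.eq_empty_or_nonempty s.inputs with he | ⟨ω₀, hω₀⟩
    · exact .vacuous he
    have key : ∀ ω ∈ s.inputs, ∃ a, o.eval (ρ v ω) (ρ w ω) = some a ∧
        ∃ y k, t.run (fun v => v.elim a fun v => ρ v ω) = some (y, k) ∧ k + 1 ≤ n := by
      intro ω hω
      obtain ⟨y, k, h, hk⟩ := ht ω hω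
      rw [CompTree.run, Option.bind_eq_some_iff] at h
      obtain ⟨a, ha, h⟩ := h
      rw [Option.map_eq_some_iff] at h
      obtain ⟨⟨y', k'⟩, h, e⟩ := h
      simp only [Prod.mk.injEq] at e
      exact ⟨a, ha, y', k', h, by omega⟩
    obtain ⟨n, rfl⟩ : ∃ m, n = m + 1 := by
      obtain ⟨_, _, _, k, _, h⟩ := key ω₀ hω₀
      exact ⟨n - 1, by omega⟩
    classical
    -- The default `0` only matters outside `s.inputs`, where the division may be undefined.
    let a : Ω → F := fun ω => (o.eval (ρ v ω) (ρ w ω)).getD 0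
    have hval : ∀ ω ∈ s.inputs, o.eval (ρ v ω) (ρ w ω) = some (a ω) := by
      intro ω hω
      obtain ⟨b, hb, _⟩ := key ω hω
      simp [a, hb]
    have := ih (fun v ω => v.elim (a ω) fun v => ρ v ω) n (s.learn a) ?_ ?_
    · refine .op o _ _ a (hρ v) (hρ w) hval (this.mono le_rfl ?_)
      rintro s' hs' ⟨out, h1, h2⟩
      refine ⟨out, h1, fun ω hω => ?_⟩
      obtain ⟨k, hk⟩ := h2 ω hω
      refine ⟨k + 1, ?_⟩
      rw [CompTree.run, hval ω (hs'.1 hω)]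
      simp only [Option.bind_some]
      rw [hk]
      rfl
    · rintro (_ | v)
      · exact Set.mem_insert _ _
      · exact Set.mem_insert_of_mem _ (hρ v)
    · intro ω hω
      obtain ⟨b, hb, y, k, h, hk⟩ := key ω hω
      have e : a ω = b := by simp [a, hb]
      exact ⟨y, k, by simpa only [e] using h, by omega⟩
  | ifZero v t e iht ihe =>
    rcases Set.eq_empty_or_nonempty s.inputs with he | ⟨ω₀, hω₀⟩
    · exact .vacuous he
    have key : ∀ ω ∈ s.inputs, ∃ y k, (open Classical in
        (if ρ v ω = 0 then t.run (fun v => ρ v ω) else e.run fun v => ρ v ω)) = some (y, k) ∧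
          k + 1 ≤ n := by
      intro ω hω
      obtain ⟨y, k, h, hk⟩ := ht ω hω
      rw [CompTree.run, Option.map_eq_some_iff] at h
      obtain ⟨⟨y', k'⟩, h, e⟩ := h
      simp only [Prod.mk.injEq] at e
      exact ⟨y', k', h, by omega⟩
    obtain ⟨n, rfl⟩ : ∃ m, n = m + 1 := by
      obtain ⟨_, k, _, h⟩ := key ω₀ hω₀
      exact ⟨n - 1, by omega⟩
    refine .test _ (hρ v)
      ((iht ρ n (s.restrict {ω | ρ v ω = 0}) hρ ?_).mono le_rfl ?_)
      ((ihe ρ n (s.restrict {ω | ρ v ω ≠ 0}) hρ ?_).mono le_rfl ?_)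
    · intro ω hω
      obtain ⟨y, k, h, hk⟩ := key ω hω.1
      rw [if_pos (show ρ v ω = 0 from hω.2)] at h
      exact ⟨y, k, h, by omega⟩
    · rintro s' hs' ⟨out, h1, h2⟩
      refine ⟨out, h1, fun ω hω => ?_⟩
      obtain ⟨k, hk⟩ := h2 ω hω
      exact ⟨k + 1, by rw [CompTree.run, if_pos (show ρ v ω = 0 from (hs'.1 hω).2), hk]; rfl⟩
    · intro ω hω
      obtain ⟨y, k, h, hk⟩ := key ω hω.1
      rw [if_neg (show ρ v ω ≠ 0 from hω.2)] at h
      exact ⟨y, k, h, by omega⟩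
    · rintro s' hs' ⟨out, h1, h2⟩
      refine ⟨out, h1, fun ω hω => ?_⟩
      obtain ⟨k, hk⟩ := h2 ω hω
      exact ⟨k + 1, by rw [CompTree.run, if_neg (show ρ v ω ≠ 0 from (hs'.1 hω).2), hk]; rfl⟩

theorem Reach.ofKnown_family {Q : Stage Ω F → Prop} {n : ℕ} {m : ℕ} {s : Stage Ω F}
    (v : Fin m → Ω → F) (hv : ∀ i, s.Has (v i))
    (h : ∀ s', s.Later s' → s'.inputs = s.inputs → ∀ a : Fin m → Ω → F, (∀ i, a i ∈ s'.known) →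
      (∀ ω ∈ s.inputs, ∀ i, a i ω = v i ω) → Reach Q n s') : Reach Q n s := by
  induction m generalizing s with
  | zero => exact h s (Later.refl s) rfl v (fun i => i.elim0) fun _ _ i => i.elim0
  | succ m ih =>
    refine Reach.ofKnown (hv 0) fun s₁ h₁ e₁ a₀ ha₀ haa => ?_
    refine ih (fun i => v i.succ) (fun i => (hv i.succ).mono h₁) fun s₂ h₂ e₂ a ha haa' => ?_
    refine h s₂ (h₁.trans h₂) (e₂.trans e₁) (Fin.cons a₀ a) (fun i => ?_) (fun ω hω i => ?_)
    · refine Fin.cases ?_ (fun i => ?_) i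
      · exact h₂.2 ha₀
      · exact ha i
    · refine Fin.cases ?_ (fun i => ?_) i
      · exact haa ω hω
      · exact haa' ω (e₁ ▸ hω) i

end Stage

/-! ### Arithmetic of polynomials -/

theorem coeff_polyOfCoeffs {F : Type u} [Field F] {n : ℕ} (a : Fin n → F) (k : ℕ) :
    (polyOfCoeffs a).coeff k = if h : k < n then a ⟨k, h⟩ else 0 := by
  rw [polyOfCoeffs, finsetSum_coeff]
  simp only [coeff_C_mul, coeff_X_pow, mul_ite, mul_one, mul_zero]
  split_ifs with h
  · rw [Finset.sum_eq_single ⟨k, h⟩]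
    · simp
    · intro b _ hb
      rw [if_neg]
      rintro rfl
      exact hb rfl
    · simp
  · exact Finset.sum_eq_zero fun b _ => if_neg (by have := b.2; omega)

theorem polyOfCoeffs_coeff {F : Type u} [Field F] {n : ℕ} {p : F[X]}
    (hp : ∀ i, n ≤ i → p.coeff i = 0) : polyOfCoeffs (fun i : Fin n => p.coeff i) = p := by
  ext k
  rw [coeff_polyOfCoeffs]
  split_ifs with h
  · rfl
  · exact (hp k (by omega)).symm

/-- The truncation of `p` modulo `X ^ n`. -/
noncomputable def lowPart {F : Type u} [Field F] (n : ℕ) (p : F[X]) : F[X] :=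
  polyOfCoeffs fun i : Fin n => p.coeff i

/-- The polynomial `p` with its `n` lowest coefficients dropped, divided by `X ^ n`. -/
noncomputable def highPart {F : Type u} [Field F] (n : ℕ) (p : F[X]) : F[X] := divX^[n] p

section

variable {F : Type u} [Field F]

theorem coeff_lowPart (n : ℕ) (p : F[X]) (k : ℕ) :
    (lowPart n p).coeff k = if k < n then p.coeff k else 0 := by
  rw [lowPart, coeff_polyOfCoeffs]
  split_ifs <;> rfl

theorem coeff_highPart (n : ℕ) (p : F[X]) (k : ℕ) :
    (highPart n p).coeff k = p.coeff (k + n) := by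
  induction n generalizing p with
  | zero => rfl
  | succ n ih =>
    rw [highPart, Function.iterate_succ_apply, ← highPart, ih, coeff_divX, add_assoc]

theorem lowPart_add_highPart (n : ℕ) (p : F[X]) : lowPart n p + X ^ n * highPart n p = p := by
  ext k
  rw [coeff_add, coeff_lowPart, coeff_X_pow_mul', coeff_highPart]
  split_ifs with h h' h'
  · omega
  · simp
  · rw [zero_add, Nat.sub_add_cancel h']
  · omega

theorem X_pow_dvd_sub_lowPart (n : ℕ) (p : F[X]) : X ^ n ∣ p - lowPart n p :=
  ⟨highPart n p, by rw [sub_eq_iff_eq_add', lowPart_add_highPart]⟩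

end

/-! ### Available polynomials, and linear operations on them. -/

namespace Stage

variable {F Ω : Type u} [Field F]

/-- The coefficients of the polynomial `p`, of degree less than `n`, are available at `s`. -/
def HasPoly (s : Stage Ω F) (n : ℕ) (p : Ω → F[X]) : Prop :=
  (∀ i, s.Has fun ω => (p ω).coeff i) ∧ ∀ ω ∈ s.inputs, ∀ i, n ≤ i → (p ω).coeff i = 0

theorem hasPoly_of_lt {s : Stage Ω F} {n : ℕ} {p : Ω → F[X]}
    (h : ∀ i < n, s.Has fun ω => (p ω).coeff i)
    (hd : ∀ ω ∈ s.inputs, ∀ i, n ≤ i → (p ω).coeff i = 0) : s.HasPoly n p := by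
  refine ⟨fun i => ?_, hd⟩
  by_cases hi : i < n
  · exact h i hi
  · exact (s.has_const 0).congr fun ω hω => (hd ω hω i (by omega)).symm

theorem HasPoly.mono {s s' : Stage Ω F} {n : ℕ} {p : Ω → F[X]} (h : s.HasPoly n p)
    (hs : s.Later s') : s'.HasPoly n p :=
  ⟨fun i => (h.1 i).mono hs, fun ω hω => h.2 ω (hs.1 hω)⟩

theorem HasPoly.congr {s : Stage Ω F} {n : ℕ} {p q : Ω → F[X]} (h : s.HasPoly n p)
    (hpq : ∀ ω ∈ s.inputs, p ω = q ω) : s.HasPoly n q :=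
  ⟨fun i => (h.1 i).congr fun ω hω => by rw [hpq ω hω], fun ω hω => hpq ω hω ▸ h.2 ω hω⟩

theorem HasPoly.le {s : Stage Ω F} {n m : ℕ} {p : Ω → F[X]} (h : s.HasPoly n p) (hm : n ≤ m) :
    s.HasPoly m p :=
  ⟨h.1, fun ω hω i hi => h.2 ω hω i (hm.trans hi)⟩

theorem HasPoly.of_degree {s : Stage Ω F} {n m : ℕ} {p : Ω → F[X]} (h : s.HasPoly n p)
    (hd : ∀ ω ∈ s.inputs, ∀ i, m ≤ i → (p ω).coeff i = 0) : s.HasPoly m p :=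
  ⟨h.1, hd⟩

theorem hasPoly_const (s : Stage Ω F) (p : F[X]) {n : ℕ} (h : ∀ i, n ≤ i → p.coeff i = 0) :
    s.HasPoly n fun _ => p :=
  ⟨fun _ => s.has_const _, fun _ _ => h⟩

theorem HasPoly.lowPart {s : Stage Ω F} {n : ℕ} {p : Ω → F[X]} (h : s.HasPoly n p) (m : ℕ) :
    s.HasPoly m fun ω => lowPart m (p ω) := by
  refine hasPoly_of_lt (fun i hi => (h.1 i).congr fun ω _ => ?_) fun ω _ i hi => ?_
  · rw [coeff_lowPart, if_pos hi]
  · rw [coeff_lowPart, if_neg (by omega)]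

theorem HasPoly.highPart {s : Stage Ω F} {n : ℕ} {p : Ω → F[X]} (h : s.HasPoly n p) (m : ℕ) :
    s.HasPoly (n - m) fun ω => highPart m (p ω) := by
  refine ⟨fun i => (h.1 (i + m)).congr fun ω _ => ?_, fun ω hω i hi => ?_⟩
  · rw [coeff_highPart]
  · rw [coeff_highPart, h.2 ω hω _ (by omega)]

theorem HasPoly.shift {s : Stage Ω F} {n : ℕ} {p : Ω → F[X]} (h : s.HasPoly n p) (m : ℕ) :
    s.HasPoly (n + m) fun ω => X ^ m * p ω := by
  refine ⟨fun i => ?_, fun ω hω i hi => ?_⟩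
  · by_cases hi : m ≤ i
    · exact (h.1 (i - m)).congr fun ω _ => by rw [coeff_X_pow_mul', if_pos hi]
    · exact (s.has_const 0).congr fun ω _ => by rw [coeff_X_pow_mul', if_neg hi]
  · rw [coeff_X_pow_mul', if_pos (by omega), h.2 ω hω _ (by omega)]

theorem HasPoly.reflect {s : Stage Ω F} {n : ℕ} {p : Ω → F[X]} (h : s.HasPoly (n + 1) p) :
    s.HasPoly (n + 1) fun ω => (p ω).reflect n := by
  refine ⟨fun i => (h.1 (revAt n i)).congr fun ω _ => (coeff_reflect ..).symm, fun ω hω i hi => ?_⟩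
  rw [coeff_reflect, revAt_eq_self_of_lt (by omega), h.2 ω hω _ hi]

/-- Computing the coefficients of a polynomial one by one. -/
theorem reach_poly (s : Stage Ω F) (n : ℕ) (p : Ω → F[X]) (c : ℕ)
    (h : ∀ i < n, ∀ s', s.Later s' → Reach (fun s' => s'.Has fun ω => (p ω).coeff i) c s')
    (hd : ∀ ω ∈ s.inputs, ∀ i, n ≤ i → (p ω).coeff i = 0) :
    Reach (fun s' => s'.HasPoly n p) (n * c) s :=
  (s.reach_forall c (fun i s' => s'.Has fun ω => (p ω).coeff i)
    (fun _ _ _ hs h => h.mono hs) n h).mono le_rfl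
    fun _ h' H => hasPoly_of_lt H fun ω hω => hd ω (h'.1 hω)

theorem reach_poly_add {s : Stage Ω F} {n : ℕ} {p q : Ω → F[X]} (hp : s.HasPoly n p)
    (hq : s.HasPoly n q) : Reach (fun s' => s'.HasPoly n fun ω => p ω + q ω) n s := by
  refine (s.reach_poly n (fun ω => p ω + q ω) 1 (fun i _ s' h => ?_) fun ω hω i hi => ?_).mono
    (by simp) fun _ _ h => h
  · simpa only [coeff_add] using s'.reach_add ((hp.1 i).mono h) ((hq.1 i).mono h)
  · rw [coeff_add, hp.2 ω hω i hi, hq.2 ω hω i hi, add_zero]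

theorem reach_poly_sub {s : Stage Ω F} {n : ℕ} {p q : Ω → F[X]} (hp : s.HasPoly n p)
    (hq : s.HasPoly n q) : Reach (fun s' => s'.HasPoly n fun ω => p ω - q ω) n s := by
  refine (s.reach_poly n (fun ω => p ω - q ω) 1 (fun i _ s' h => ?_) fun ω hω i hi => ?_).mono
    (by simp) fun _ _ h => h
  · simpa only [coeff_sub] using s'.reach_sub ((hp.1 i).mono h) ((hq.1 i).mono h)
  · rw [coeff_sub, hp.2 ω hω i hi, hq.2 ω hω i hi, sub_zero]

theorem reach_poly_C_mul {s : Stage Ω F} {n : ℕ} {a : Ω → F} {p : Ω → F[X]} (ha : s.Has a)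
    (hp : s.HasPoly n p) : Reach (fun s' => s'.HasPoly n fun ω => C (a ω) * p ω) n s := by
  refine (s.reach_poly n (fun ω => C (a ω) * p ω) 1 (fun i _ s' h => ?_) fun ω hω i hi => ?_).mono
    (by simp) fun _ _ h => h
  · simpa only [coeff_C_mul] using s'.reach_mul (ha.mono h) ((hp.1 i).mono h)
  · rw [coeff_C_mul, hp.2 ω hω i hi, mul_zero]

end Stage

/-! ### Cost of polynomial multiplication. -/

theorem coeff_mul_eq_zero_of_le {F : Type u} [Field F] {p q : F[X]} {n m : ℕ}
    (hp : ∀ i, n ≤ i → p.coeff i = 0) (hq : ∀ i, m ≤ i → q.coeff i = 0) (i : ℕ)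
    (hi : n + m ≤ i + 1) : (p * q).coeff i = 0 := by
  rw [coeff_mul]
  refine Finset.sum_eq_zero fun x hx => ?_
  rw [Finset.HasAntidiagonal.mem_antidiagonal] at hx
  by_cases h : n ≤ x.1
  · rw [hp _ h, zero_mul]
  · rw [hq x.2 (by omega), mul_zero]

/-- Polynomials of degree less than `n` over `F` can be multiplied in `c` operations. -/
structure MulCost (F : Type u) [Field F] (n c : ℕ) : Prop where
  reach : ∀ {Ω : Type u} (s : Stage Ω F) (p q : Ω → F[X]), s.HasPoly n p → s.HasPoly n q →
    Stage.Reach (fun s' => s'.HasPoly (2 * n) fun ω => p ω * q ω) c s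

section

variable {F : Type u} [Field F]

theorem IsMultiplicationTime.mulCost {M : ℕ → ℕ} (hM : IsMultiplicationTime F M) {n : ℕ}
    (hn : 0 < n) : MulCost F n (M n) := by
  constructor
  intro Ω s p q hp hq
  obtain ⟨P, hP⟩ := hM.exists_mul n hn
  refine Stage.Reach.ofKnown_family (fun (i : Fin n) ω => (p ω).coeff i) (fun i => hp.1 i)
    fun s₁ h₁ e₁ a ha haa => ?_
  refine Stage.Reach.ofKnown_family (fun (i : Fin n) ω => (q ω).coeff i)
    (fun i => (hq.1 i).mono h₁) fun s₂ h₂ e₂ b hb hbb => ?_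
  have key : ∀ ω ∈ s₂.inputs, ∃ k : ℕ, P.run (fun v => Sum.elim a b v ω) =
      some (fun i : Fin (2 * n - 1) => (p ω * q ω).coeff i, k) ∧ k ≤ M n := by
    intro ω hω
    rw [e₂] at hω
    have hω' := hω
    rw [e₁] at hω'
    obtain ⟨k, h, hk⟩ := hP (fun i => (p ω).coeff i) (fun i => (q ω).coeff i)
    refine ⟨k, ?_, by exact_mod_cast hk⟩
    rw [polyOfCoeffs_coeff (hp.2 ω hω'), polyOfCoeffs_coeff (hq.2 ω hω')] at h
    rw [← h]
    congr 1
    ext (i | i)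
    · exact haa ω hω' i
    · exact hbb ω hω i
  refine (s₂.reach_run P (Sum.elim a b) (M n) ?_ ?_).mono le_rfl ?_
  · rintro (v | v)
    · exact h₂.2 (ha v)
    · exact hb v
  · intro ω hω
    obtain ⟨k, h⟩ := key ω hω
    exact ⟨_, k, h⟩
  · rintro s₃ h₃ ⟨out, h, hout⟩
    have hd : ∀ ω ∈ s₃.inputs, ∀ i, 2 * n - 1 ≤ i → (p ω * q ω).coeff i = 0 := by
      intro ω hω i hi
      have hω' := ((h₁.trans h₂).trans h₃).1 hω
      exact coeff_mul_eq_zero_of_le (hp.2 ω hω') (hq.2 ω hω') i (by omega)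
    refine Stage.HasPoly.le (n := 2 * n - 1) (Stage.hasPoly_of_lt (fun i hi => ?_) hd) (by omega)
    refine (h ⟨i, hi⟩).congr fun ω hω => ?_
    obtain ⟨k, hk⟩ := hout ω hω
    obtain ⟨k', hk', _⟩ := key ω (h₃.1 hω)
    rw [hk', Option.some_inj, Prod.mk.injEq] at hk
    exact (congrFun hk.1 ⟨i, hi⟩).symm

theorem MulCost.mono {n m c c' : ℕ} (h : MulCost F n c) (hm : m ≤ n) (hc : c ≤ c') :
    MulCost F m c' := by
  constructor
  intro Ω s p q hp hq
  refine (h.reach s p q (hp.le hm) (hq.le hm)).mono hc fun s' hs H =>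
    H.of_degree fun ω hω i hi => ?_
  exact coeff_mul_eq_zero_of_le (hp.2 ω (hs.1 hω)) (hq.2 ω (hs.1 hω)) i (by omega)

/-- Super-linearity bounds `M` only from below, so `M (2 * n)` cannot be compared with `M n`. Longer
products are instead cut into four products of length `n`, joined by three additions of length `4 *
n`. -/
theorem MulCost.double {n c : ℕ} (h : MulCost F n c) : MulCost F (2 * n) (4 * c + 12 * n) := by
  replace h := @h.reach
  constructor
  intro Ω s p q hp hq
  let p0 := fun ω => lowPart n (p ω)
  let p1 := fun ω => highPart n (p ω)
  let q0 := fun ω => lowPart n (q ω)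
  let q1 := fun ω => highPart n (q ω)
  have hp0 : s.HasPoly n p0 := hp.lowPart n
  have hq0 : s.HasPoly n q0 := hq.lowPart n
  have hp1 : s.HasPoly n p1 := (hp.highPart n).le (by omega)
  have hq1 : s.HasPoly n q1 := (hq.highPart n).le (by omega)
  refine (h s p0 q0 hp0 hq0).bind (m := 3 * c + 12 * n) _ (by omega) fun s₁ h₁ H₁ => ?_
  refine (h s₁ p0 q1 (hp0.mono h₁) (hq1.mono h₁)).bind (m := 2 * c + 12 * n) _ (by omega)
    fun s₂ h₂ H₂ => ?_
  have h₂' := h₁.trans h₂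
  refine (h s₂ p1 q0 (hp1.mono h₂') (hq0.mono h₂')).bind (m := c + 12 * n) _ (by omega)
    fun s₃ h₃ H₃ => ?_
  have h₃' := h₂'.trans h₃
  refine (h s₃ p1 q1 (hp1.mono h₃') (hq1.mono h₃')).bind (m := 12 * n) _ (by omega)
    fun s₄ h₄ H₄ => ?_
  refine (Stage.reach_poly_add (n := 4 * n)
    ((H₂.mono (h₃.trans h₄)).le (by omega))
    ((H₃.mono h₄).le (by omega))).bind (m := 8 * n) _ (by omega) fun s₅ h₅ H₅ => ?_
  have H₅' : s₅.HasPoly (4 * n) fun ω => X ^ n * (p0 ω * q1 ω + p1 ω * q0 ω) := by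
    refine (H₅.shift n).of_degree fun ω hω i hi => ?_
    have hω' := (h₃'.trans (h₄.trans h₅)).1 hω
    rw [coeff_X_pow_mul', if_pos (by omega), coeff_add,
      coeff_mul_eq_zero_of_le (hp0.2 ω hω') (hq1.2 ω hω') _ (by omega),
      coeff_mul_eq_zero_of_le (hp1.2 ω hω') (hq0.2 ω hω') _ (by omega), add_zero]
  refine (Stage.reach_poly_add (n := 4 * n)
    ((H₁.mono (h₂.trans (h₃.trans (h₄.trans h₅)))).le (by omega)) H₅').bind (m := 4 * n) _
    (by omega) fun s₆ h₆ H₆ => ?_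
  refine (Stage.reach_poly_add H₆
    (((H₄.shift (2 * n)).mono (h₅.trans h₆)).le (by omega))).mono (by omega) fun s₇ h₇ H₇ => ?_
  refine (H₇.congr fun ω _ => ?_).le (by omega)
  rw [← lowPart_add_highPart n (p ω), ← lowPart_add_highPart n (q ω)]
  simp only [p0, p1, q0, q1]
  ring

theorem IsMultiplicationTime.mono {M : ℕ → ℕ} (hM : IsMultiplicationTime F M) {m n : ℕ}
    (hm : 0 < m) (h : m ≤ n) : M m ≤ M n := by
  obtain ⟨k, rfl⟩ := Nat.exists_eq_add_of_le h
  rcases Nat.eq_zero_or_pos k with rfl | hk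
  · exact le_rfl
  · have := hM.add_le m k hm hk
    omega

theorem IsMultiplicationTime.mulCost_two {M : ℕ → ℕ} (hM : IsMultiplicationTime F M) {n : ℕ}
    (hn : 0 < n) : MulCost F (2 * n) (16 * M n) := by
  have := hM.le_self n hn
  exact (hM.mulCost hn).double.mono le_rfl (by omega)

end

/-! ### Power series inversion and division with remainder -/

section

variable {F : Type u} [Field F]

/-- Newton iteration: `τ * (I * (2 - τ * I)) - 1 = -(τ * I - 1) ^ 2`, and both truncations are
invisible modulo `X ^ k`. -/
theorem X_pow_dvd_newton {N m k : ℕ} {τ I : F[X]} (h : X ^ m ∣ τ * I - 1) (hk : k ≤ 2 * m)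
    (hN : k ≤ N) : X ^ k ∣ τ * lowPart N (I * (2 - lowPart N (τ * I))) - 1 := by
  have h1 := (pow_dvd_pow X hN).trans (X_pow_dvd_sub_lowPart N (τ * I))
  have h2 := (pow_dvd_pow X hN).trans
    (X_pow_dvd_sub_lowPart N (I * (2 - lowPart N (τ * I))))
  have h3 : X ^ k ∣ (τ * I - 1) * (τ * I - 1) := by
    refine (pow_dvd_pow X hk).trans ?_
    rw [two_mul, pow_add]
    exact mul_dvd_mul h h
  obtain ⟨a, ha⟩ := h1
  obtain ⟨b, hb⟩ := h2
  obtain ⟨c, hc⟩ := h3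
  refine ⟨τ * I * a - τ * b - c, ?_⟩
  linear_combination (-τ) * hb - hc + τ * I * ha

theorem natDegree_le_of_coeff {p : F[X]} {n : ℕ} (h : ∀ i, n + 1 ≤ i → p.coeff i = 0) :
    p.natDegree ≤ n :=
  natDegree_le_iff_coeff_eq_zero.mpr fun i hi => h i hi

/-- Reversal turns Euclidean division into division of power series. With `q` so defined, the
reversal of `A - q * B` is divisible by `X ^ (N - e)`, which says that `A - q * B` has degree less
than `e`; uniqueness of the quotient concludes. -/
theorem divByMonic_eq_reflect {A B I : F[X]} {N e : ℕ} (hB : B.Monic) (he : B.natDegree = e)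
    (heN : e < N) (hA : ∀ i, N ≤ i → A.coeff i = 0) (hI : X ^ N ∣ B.reflect e * I - 1) :
    A /ₘ B = (lowPart (N - e) (A.reflect (N - 1) * I)).reflect (N - e - 1) := by
  set q' := lowPart (N - e) (A.reflect (N - 1) * I) with hq'
  set q := q'.reflect (N - e - 1) with hq
  have hq'd : q'.natDegree ≤ N - e - 1 := natDegree_le_of_coeff fun i hi => by
    rw [hq', coeff_lowPart, if_neg (by omega)]
  have hqd : q.natDegree ≤ N - e - 1 := natDegree_le_of_coeff fun i hi => by
    rw [hq, coeff_reflect, revAt_eq_self_of_lt (by omega), hq', coeff_lowPart, if_neg (by omega)]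
  have hrev : (q * B).reflect (N - 1) = q' * B.reflect e := by
    have : N - 1 = N - e - 1 + e := by omega
    rw [this, reflect_mul q B hqd he.le]
    congr 1
    ext i
    simp [hq]
  have hdvd : X ^ (N - e) ∣ (A - q * B).reflect (N - 1) := by
    rw [reflect_sub, hrev]
    obtain ⟨a, ha⟩ := X_pow_dvd_sub_lowPart (N - e) (A.reflect (N - 1) * I)
    obtain ⟨b, hb⟩ := (pow_dvd_pow X (Nat.sub_le N e)).trans hI
    refine ⟨a * B.reflect e - A.reflect (N - 1) * b, ?_⟩
    rw [← hq'] at ha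
    linear_combination B.reflect e * ha - A.reflect (N - 1) * hb
  refine (div_modByMonic_unique q (A - q * B) hB ⟨by ring, ?_⟩).1
  rw [degree_eq_natDegree hB.ne_zero, he, degree_lt_iff_coeff_zero]
  intro i hi
  by_cases hiN : i < N
  · have := X_pow_dvd_iff.mp hdvd (N - 1 - i) (by omega)
    rwa [coeff_reflect, revAt_le (by omega), Nat.sub_sub_self (by omega)] at this
  · rw [coeff_sub, hA i (by omega), coeff_eq_zero_of_natDegree_lt, sub_zero]
    have := natDegree_mul_le (p := q) (q := B)
    omega

end

/-! ### Algorithms for power series inversion and Euclidean division. -/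

namespace Stage

variable {F Ω : Type u} [Field F]

theorem reach_newton {N c : ℕ} (hM : MulCost F N c) (hN : 0 < N) {s : Stage Ω F}
    {τ I : Ω → F[X]} (hτ : s.HasPoly N τ) (hI : s.HasPoly N I) {m k : ℕ}
    (h : ∀ ω ∈ s.inputs, X ^ m ∣ τ ω * I ω - 1) (hk : k ≤ 2 * m) (hkN : k ≤ N) :
    Reach (fun s' => ∃ J, s'.HasPoly N J ∧ ∀ ω ∈ s'.inputs, X ^ k ∣ τ ω * J ω - 1)
      (2 * c + N) s := by
  refine (hM.reach s τ I hτ hI).bind (m := c + N) _ (by omega) fun s₁ h₁ H₁ => ?_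
  have h2 : s₁.HasPoly N fun _ => (2 : F[X]) := s₁.hasPoly_const 2 fun i hi => by
    rw [← C_ofNat, coeff_C, if_neg (by omega)]
  refine (reach_poly_sub h2 (H₁.lowPart N)).bind (m := c) _ (by omega) fun s₂ h₂ H₂ => ?_
  refine (hM.reach s₂ I _ (hI.mono (h₁.trans h₂)) H₂).mono le_rfl fun s₃ h₃ H₃ => ?_
  exact ⟨_, H₃.lowPart N, fun ω hω =>
    X_pow_dvd_newton (h ω ((h₁.trans (h₂.trans h₃)).1 hω)) hk hkN⟩

theorem reach_inverse {M : ℕ → ℕ} (hM : IsMultiplicationTime F M) {n : ℕ} (hn : 0 < n)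
    {s : Stage Ω F} {τ : Ω → F[X]} (hτ : s.HasPoly n τ)
    (h1 : ∀ ω ∈ s.inputs, (τ ω).coeff 0 = 1) :
    Reach (fun s' => ∃ I, s'.HasPoly n I ∧ ∀ ω ∈ s'.inputs, X ^ n ∣ τ ω * I ω - 1)
      (12 * M n) s := by
  induction n using Nat.strong_induction_on generalizing s τ with
  | _ n ih =>
  rcases Nat.lt_or_ge n 2 with hn2 | hn2
  · obtain rfl : n = 1 := by omega
    refine .done ⟨fun _ => 1, s.hasPoly_const 1 fun i hi => ?_, fun ω hω => ?_⟩
    · rw [← C_1, coeff_C, if_neg (by omega)]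
    · rw [pow_one, X_dvd_iff]
      simp [h1 ω hω]
  · have hm : 0 < n / 2 := by omega
    have hle := hM.le_self n hn
    have hMm : M (n / 2) + M (n / 2) ≤ M n :=
      (hM.add_le _ _ hm hm).trans (hM.mono (by omega) (by omega))
    refine (ih (n / 2) (by omega) hm (hτ.lowPart (n / 2)) fun ω hω => ?_).bind (m := 6 * M n) _
      (by omega) ?_
    · rw [coeff_lowPart, if_pos hm, h1 ω hω]
    rintro s₁ h₁ ⟨I, hI, hI1⟩
    have hI2 : ∀ ω ∈ s₁.inputs, X ^ (n / 2) ∣ τ ω * I ω - 1 := by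
      intro ω hω
      obtain ⟨a, ha⟩ := X_pow_dvd_sub_lowPart (n / 2) (τ ω)
      obtain ⟨b, hb⟩ := hI1 ω hω
      exact ⟨a * I ω + b, by linear_combination I ω * ha + hb⟩
    -- Doubling `n / 2` is only sure to reach precision `n - 1`, so a second Newton step follows.
    refine (reach_newton (hM.mulCost hn) hn (hτ.mono h₁) (hI.le (by omega)) hI2
      (k := n - 1) (by omega) (by omega)).bind (m := 2 * M n + n) _ (by omega) ?_
    rintro s₂ h₂ ⟨J, hJ, hJ1⟩
    refine (reach_newton (hM.mulCost hn) hn (hτ.mono (h₁.trans h₂)) hJ hJ1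
      (k := n) (by omega) (by omega)).mono le_rfl fun _ _ h => h

/-- The last Newton step, from `n` to `2 * n`, uses split products, which keeps the bound in terms
of `M n`. -/
theorem reach_inverse_two {M : ℕ → ℕ} (hM : IsMultiplicationTime F M) {n : ℕ} (hn : 0 < n)
    {s : Stage Ω F} {τ : Ω → F[X]} (hτ : s.HasPoly (2 * n) τ)
    (h1 : ∀ ω ∈ s.inputs, (τ ω).coeff 0 = 1) :
    Reach (fun s' => ∃ I, s'.HasPoly (2 * n) I ∧ ∀ ω ∈ s'.inputs, X ^ (2 * n) ∣ τ ω * I ω - 1)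
      (46 * M n) s := by
  have hle := hM.le_self n hn
  refine (reach_inverse hM hn (hτ.lowPart n) fun ω hω => ?_).bind (m := 34 * M n) _ (by omega) ?_
  · rw [coeff_lowPart, if_pos hn, h1 ω hω]
  rintro s₁ h₁ ⟨I, hI, hI1⟩
  have hI2 : ∀ ω ∈ s₁.inputs, X ^ n ∣ τ ω * I ω - 1 := by
    intro ω hω
    obtain ⟨a, ha⟩ := X_pow_dvd_sub_lowPart n (τ ω)
    obtain ⟨b, hb⟩ := hI1 ω hω
    exact ⟨a * I ω + b, by linear_combination I ω * ha + hb⟩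
  exact (reach_newton (hM.mulCost_two hn) (by omega) (hτ.mono h₁) (hI.le (by omega)) hI2
    le_rfl le_rfl).mono (by omega) fun _ _ h => h

/-- The cost is `46 * M n` for the inverse of the reversed divisor, `16 * M n` for each of the
products giving the quotient and its multiple of `B`, and `2 * n` for the subtraction. -/
theorem reach_divMod {M : ℕ → ℕ} (hM : IsMultiplicationTime F M) {n : ℕ} (hn : 0 < n)
    {s : Stage Ω F} {A B : Ω → F[X]} {e : ℕ} (hA : s.HasPoly (2 * n) A)
    (hB : s.HasPoly (2 * n) B) (he : e < 2 * n) (hB1 : ∀ ω ∈ s.inputs, (B ω).Monic)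
    (hBe : ∀ ω ∈ s.inputs, (B ω).natDegree = e) :
    Reach (fun s' => s'.HasPoly (2 * n - e) (fun ω => A ω /ₘ B ω) ∧
      s'.HasPoly e fun ω => A ω %ₘ B ω) (80 * M n) s := by
  have hle := hM.le_self n hn
  have hB' : s.HasPoly (e + 1) B := hB.of_degree fun ω hω i hi =>
    coeff_eq_zero_of_natDegree_lt (by rw [hBe ω hω]; omega)
  refine (reach_inverse_two hM hn (hB'.reflect.le (by omega)) fun ω hω => ?_).bind
    (m := 34 * M n) _ (by omega) ?_
  · rw [coeff_reflect, revAt_le (Nat.zero_le _), Nat.sub_zero, ← hBe ω hω]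
    exact hB1 ω hω
  rintro s₁ h₁ ⟨I, hI, hI1⟩
  have hA' : s.HasPoly (2 * n) fun ω => (A ω).reflect (2 * n - 1) :=
    (HasPoly.reflect (n := 2 * n - 1) (hA.le (by omega))).le (by omega)
  refine ((hM.mulCost_two hn).reach s₁ _ I (hA'.mono h₁) hI).bind (m := 18 * M n) _ (by omega)
    fun s₂ h₂ H₂ => ?_
  have hq : s₂.HasPoly (2 * n - e) fun ω => A ω /ₘ B ω := by
    have h := (HasPoly.reflect (n := 2 * n - e - 1)
      ((H₂.lowPart (2 * n - e)).le (by omega))).le (m := 2 * n - e) (by omega)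
    refine h.congr fun ω hω => ?_
    have hω₀ := (h₁.trans h₂).1 hω
    exact (divByMonic_eq_reflect (hB1 ω hω₀) (hBe ω hω₀) he (hA.2 ω hω₀) (hI1 ω (h₂.1 hω))).symm
  refine ((hM.mulCost_two hn).reach s₂ _ B (hq.le (by omega)) (hB.mono (h₁.trans h₂))).bind
    (m := 2 * n) _ (by omega) fun s₃ h₃ H₃ => ?_
  have h₃' := h₁.trans (h₂.trans h₃)
  have hr : ∀ ω ∈ s.inputs, A ω - A ω /ₘ B ω * B ω = A ω %ₘ B ω := fun ω hω => by
    rw [modByMonic_eq_sub_mul_div, mul_comm]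
  have hd : ∀ ω ∈ s.inputs, ∀ i, e ≤ i → (A ω %ₘ B ω).coeff i = 0 := fun ω hω i hi => by
    have := degree_modByMonic_lt (A ω) (hB1 ω hω)
    rw [degree_eq_natDegree (hB1 ω hω).ne_zero, hBe ω hω, degree_lt_iff_coeff_zero] at this
    exact this i hi
  refine (reach_poly_sub (n := 2 * n) (hA.mono h₃') (H₃.of_degree fun ω hω i hi => ?_)).mono le_rfl
    fun s₄ h₄ H₄ => ⟨hq.mono (h₃.trans h₄),
      (H₄.congr fun ω hω => hr ω ((h₃'.trans h₄).1 hω)).of_degree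
        fun ω hω => hd ω ((h₃'.trans h₄).1 hω)⟩
  have hω' := h₃'.1 hω
  have : A ω /ₘ B ω * B ω = A ω - A ω %ₘ B ω := by rw [← hr ω hω']; ring
  rw [this, coeff_sub, hA.2 ω hω' i hi, hd ω hω' i (by omega), sub_zero]

end Stage

/-! ### Division steps

A division step in the sense of Bernstein and Yang eliminates the constant coefficient of one of two
power series `f`, `g`; the number of steps and the sizes of all objects do not depend on the
data. -/

/-- The state of a sequence of division steps. -/
structure DivState (F : Type u) [Field F] where
  δ : ℤ
  f : F[X]
  g : F[X]

namespace DivState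

variable {F : Type u} [Field F]

/-- The condition under which a division step exchanges `f` and `g`. -/
def Swaps (t : DivState F) : Prop := 0 < t.δ ∧ t.g.coeff 0 ≠ 0

open Classical in
/-- One division step. -/
noncomputable def next (t : DivState F) : DivState F :=
  if t.Swaps then
    ⟨1 - t.δ, t.g, divX (C (t.g.coeff 0) * t.f - C (t.f.coeff 0) * t.g)⟩
  else ⟨1 + t.δ, t.f, divX (C (t.f.coeff 0) * t.g - C (t.g.coeff 0) * t.f)⟩

open Classical in
/-- The matrix of a division step, scaled by `X`. -/
noncomputable def stepMatrix (t : DivState F) : Matrix (Fin 2) (Fin 2) F[X] :=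
  if t.Swaps then !![0, X; C (t.g.coeff 0), -C (t.f.coeff 0)]
  else !![X, 0; -C (t.g.coeff 0), C (t.f.coeff 0)]

/-- The matrix of `n` division steps, scaled by `X ^ n`. -/
noncomputable def trans : ℕ → DivState F → Matrix (Fin 2) (Fin 2) F[X]
  | 0, _ => 1
  | n + 1, t => trans n t.next * t.stepMatrix

theorem trans_one (t : DivState F) : trans 1 t = t.stepMatrix := by
  simp [trans]

theorem trans_add (m n : ℕ) (t : DivState F) :
    trans (m + n) t = trans n (next^[m] t) * trans m t := by
  induction m generalizing t with
  | zero => simp [trans]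
  | succ m ih => rw [Nat.succ_add, trans, ih, trans, Matrix.mul_assoc, Function.iterate_succ_apply]

theorem X_mul_divX_of_coeff_zero {p : F[X]} (h : p.coeff 0 = 0) : X * divX p = p := by
  conv_rhs => rw [← X_mul_divX_add p, h, C_0, add_zero]

theorem X_mul_next_f (t : DivState F) :
    X * t.next.f = t.stepMatrix 0 0 * t.f + t.stepMatrix 0 1 * t.g := by
  unfold next stepMatrix
  split_ifs <;> simp

theorem X_mul_next_g (t : DivState F) :
    X * t.next.g = t.stepMatrix 1 0 * t.f + t.stepMatrix 1 1 * t.g := by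
  unfold next stepMatrix
  split_ifs
  · simp only
    rw [X_mul_divX_of_coeff_zero (by simp [mul_comm])]
    simp; ring
  · simp only
    rw [X_mul_divX_of_coeff_zero (by simp [mul_comm])]
    simp; ring

theorem X_pow_mul_iterate (n : ℕ) (t : DivState F) :
    X ^ n * (next^[n] t).f = trans n t 0 0 * t.f + trans n t 0 1 * t.g ∧
    X ^ n * (next^[n] t).g = trans n t 1 0 * t.f + trans n t 1 1 * t.g := by
  induction n generalizing t with
  | zero => simp [trans]
  | succ n ih =>
    obtain ⟨h1, h2⟩ := ih t.next
    rw [Function.iterate_succ_apply, trans, pow_succ']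
    simp only [Matrix.mul_apply, Fin.sum_univ_two]
    constructor
    · linear_combination X * h1 + trans n t.next 0 0 * X_mul_next_f t +
        trans n t.next 0 1 * X_mul_next_g t
    · linear_combination X * h2 + trans n t.next 1 0 * X_mul_next_f t +
        trans n t.next 1 1 * X_mul_next_g t

/-- The first `n` division steps from `t` and from `t'` are the same. -/
def Agree (n : ℕ) (t t' : DivState F) : Prop :=
  t.δ = t'.δ ∧ ∀ i < n, t.f.coeff i = t'.f.coeff i ∧ t.g.coeff i = t'.g.coeff i

/-- A step looks only at `δ` and at the two constant coefficients, and its division by `X` uses up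
one coefficient of precision. -/
theorem Agree.next {n : ℕ} {t t' : DivState F} (h : Agree (n + 1) t t') :
    Agree n t.next t'.next ∧ t.stepMatrix = t'.stepMatrix := by
  have h0 := h.2 0 n.succ_pos
  have hs : t.Swaps ↔ t'.Swaps := by rw [Swaps, Swaps, h.1, h0.2]
  unfold DivState.next stepMatrix
  by_cases hsw : t.Swaps
  · rw [if_pos hsw, if_pos hsw, if_pos (hs.mp hsw), if_pos (hs.mp hsw), h0.1, h0.2]
    refine ⟨⟨by rw [h.1], fun i hi => ⟨(h.2 i (by omega)).2, ?_⟩⟩, rfl⟩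
    have := h.2 (i + 1) (by omega)
    simp [coeff_divX, this.1, this.2]
  · rw [if_neg hsw, if_neg hsw, if_neg (mt hs.mpr hsw), if_neg (mt hs.mpr hsw), h0.1, h0.2]
    refine ⟨⟨by rw [h.1], fun i hi => ⟨(h.2 i (by omega)).1, ?_⟩⟩, rfl⟩
    have := h.2 (i + 1) (by omega)
    simp [coeff_divX, this.1, this.2]

/-- Locality of division steps: the matrix of `n` steps can be computed from truncations modulo `X ^
n`, which is what makes a half-gcd recursion possible. -/
theorem Agree.iterate {n : ℕ} {t t' : DivState F} (h : Agree n t t') :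
    (DivState.next^[n] t).δ = (DivState.next^[n] t').δ ∧ trans n t = trans n t' := by
  induction n generalizing t t' with
  | zero => exact ⟨h.1, rfl⟩
  | succ n ih =>
    obtain ⟨h1, h2⟩ := h.next
    obtain ⟨h3, h4⟩ := ih h1
    exact ⟨h3, by rw [trans, trans, h4, h2]⟩

/-- The state with `f` and `g` truncated. -/
noncomputable def low (n : ℕ) (t : DivState F) : DivState F :=
  ⟨t.δ, lowPart n t.f, lowPart n t.g⟩

theorem agree_low {m n : ℕ} (h : m ≤ n) (t : DivState F) : Agree m (t.low n) t :=
  ⟨rfl, fun i hi => by simp [low, coeff_lowPart, show i < n by omega]⟩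

theorem coeff_stepMatrix (t : DivState F) (i j : Fin 2) (k : ℕ) (hk : 2 ≤ k) :
    (t.stepMatrix i j).coeff k = 0 := by
  unfold stepMatrix
  split_ifs <;> fin_cases i <;> fin_cases j <;>
    simp [coeff_X, coeff_C, show k ≠ 0 by omega, show 1 ≠ k by omega]

theorem coeff_trans (n : ℕ) (t : DivState F) (i j : Fin 2) (k : ℕ) (hk : n + 1 ≤ k) :
    (trans n t i j).coeff k = 0 := by
  induction n generalizing t i j k with
  | zero =>
    rw [trans, Matrix.one_apply]
    split_ifs
    · rw [← C_1, coeff_C, if_neg (by omega)]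
    · simp
  | succ n ih =>
    rw [trans, Matrix.mul_apply, Fin.sum_univ_two, coeff_add]
    rw [coeff_mul_eq_zero_of_le (ih t.next i 0) (coeff_stepMatrix t 0 j) k (by omega),
      coeff_mul_eq_zero_of_le (ih t.next i 1) (coeff_stepMatrix t 1 j) k (by omega), add_zero]

end DivState

/-! ### Fast computation of the matrices of division steps. -/

namespace Stage

variable {F Ω : Type u} [Field F]

/-- The entries of the matrix `P`, of degree less than `n`, are available at `s`. -/
def HasMatrix (s : Stage Ω F) (n : ℕ) (P : Ω → Matrix (Fin 2) (Fin 2) F[X]) : Prop :=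
  ∀ i j, s.HasPoly n fun ω => P ω i j

theorem HasMatrix.mono {s s' : Stage Ω F} {n : ℕ} {P : Ω → Matrix (Fin 2) (Fin 2) F[X]}
    (h : s.HasMatrix n P) (hs : s.Later s') : s'.HasMatrix n P :=
  fun i j => (h i j).mono hs

theorem reach_fin_two (s : Stage Ω F) (c : ℕ) (P : Fin 2 → Stage Ω F → Prop)
    (hP : ∀ i s₁ s₂, s₁.Later s₂ → P i s₁ → P i s₂)
    (h : ∀ i, ∀ s', s.Later s' → Reach (P i) c s') : Reach (fun s' => ∀ i, P i s') (2 * c) s := by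
  refine (h 0 s (Later.refl s)).bind (m := c) _ (by omega) fun s₁ h₁ H₁ => ?_
  refine (h 1 s₁ h₁).mono le_rfl fun s₂ h₂ H₂ i => ?_
  fin_cases i
  · exact hP 0 _ _ h₂ H₁
  · exact H₂

theorem reach_mul_add_mul {N c : ℕ} (hM : MulCost F N c) {s : Stage Ω F} {p q p' q' : Ω → F[X]}
    (hp : s.HasPoly N p) (hq : s.HasPoly N q) (hp' : s.HasPoly N p') (hq' : s.HasPoly N q') :
    Reach (fun s' => s'.HasPoly (2 * N) fun ω => p ω * q ω + p' ω * q' ω) (2 * c + 2 * N) s := by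
  refine (hM.reach s p q hp hq).bind (m := c + 2 * N) _ (by omega) fun s₁ h₁ H₁ => ?_
  refine (hM.reach s₁ p' q' (hp'.mono h₁) (hq'.mono h₁)).bind (m := 2 * N) _ (by omega)
    fun s₂ h₂ H₂ => ?_
  exact reach_poly_add (H₁.mono h₂) H₂

theorem reach_matrix_mul {N c : ℕ} (hM : MulCost F N c) {s : Stage Ω F}
    {P Q : Ω → Matrix (Fin 2) (Fin 2) F[X]} (hP : s.HasMatrix N P) (hQ : s.HasMatrix N Q) :
    Reach (fun s' => s'.HasMatrix (2 * N) fun ω => P ω * Q ω) (8 * c + 8 * N) s := by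
  refine (s.reach_fin_two (2 * (2 * c + 2 * N))
    (fun i s' => ∀ j, s'.HasPoly (2 * N) fun ω => (P ω * Q ω) i j)
    (fun _ _ _ hs h j => (h j).mono hs) fun i s₁ h₁ => ?_).mono (by omega) fun _ _ h => h
  refine s₁.reach_fin_two _ (fun j s' => s'.HasPoly (2 * N) fun ω => (P ω * Q ω) i j)
    (fun _ _ _ hs h => h.mono hs) fun j s₂ h₂ => ?_
  have h₂' := h₁.trans h₂
  simp only [Matrix.mul_apply, Fin.sum_univ_two]
  exact reach_mul_add_mul hM ((hP i 0).mono h₂') ((hQ 0 j).mono h₂') ((hP i 1).mono h₂')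
    ((hQ 1 j).mono h₂')

/-- The state `t` is at hand: `δ` is constant, and the coefficients of `f` and `g` are available. -/
def HasState (s : Stage Ω F) (n : ℕ) (t : Ω → DivState F) : Prop :=
  (∃ δ, ∀ ω ∈ s.inputs, (t ω).δ = δ) ∧ s.HasPoly n (fun ω => (t ω).f) ∧
    s.HasPoly n fun ω => (t ω).g

end Stage

/-- The matrix of `n` division steps can be computed in `k` operations. -/
structure TransCost (F : Type u) [Field F] (n k : ℕ) : Prop where
  reach : ∀ {Ω : Type u} (s : Stage Ω F) (t : Ω → DivState F), s.HasState n t →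
    Stage.Reach (fun s' => (∃ δ, ∀ ω ∈ s'.inputs, (DivState.next^[n] (t ω)).δ = δ) ∧
      s'.HasMatrix (n + 1) fun ω => DivState.trans n (t ω)) k s

section

variable {F : Type u} [Field F]

open Stage

theorem TransCost.mono {n k k' : ℕ} (h : TransCost F n k) (hk : k ≤ k') : TransCost F n k' :=
  ⟨fun s t ht => (h.reach s t ht).mono hk fun _ _ h => h⟩

theorem transCost_one : TransCost F 1 2 := by
  constructor
  rintro Ω s t ⟨⟨δ, hδ⟩, hf, hg⟩
  have hX : ∀ s : Stage Ω F, s.HasPoly 2 fun _ => X := fun s =>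
    s.hasPoly_const X fun i hi => by rw [coeff_X, if_neg (by omega)]
  have h0 : ∀ s : Stage Ω F, s.HasPoly 2 fun _ => 0 := fun s => s.hasPoly_const 0 fun i hi => rfl
  have hC : ∀ {s : Stage Ω F} {a : Ω → F}, s.Has a → s.HasPoly 2 fun ω => C (a ω) := by
    intro s a ha
    refine ⟨fun i => ?_, fun ω _ i hi => by rw [coeff_C, if_neg (by omega)]⟩
    by_cases hi : i = 0
    · exact ha.congr fun ω _ => by rw [coeff_C, if_pos hi]
    · exact (s.has_const 0).congr fun ω _ => by rw [coeff_C, if_neg hi]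
  refine (s.reach_test (hg.1 0)).bind (m := 1) _ le_rfl fun s₁ h₁ H₁ => ?_
  -- The sign of `δ` is known at the node and costs nothing; only the zero test on the constant
  -- coefficient of `g` is paid for.
  have hsw : (∀ ω ∈ s₁.inputs, (t ω).Swaps) ∨ ∀ ω ∈ s₁.inputs, ¬(t ω).Swaps := by
    rcases H₁ with H | H
    · exact .inr fun ω hω h => h.2 (H ω hω)
    · by_cases hd : 0 < δ
      · exact .inl fun ω hω => ⟨(hδ ω (h₁.1 hω)).symm ▸ hd, H ω hω⟩
      · exact .inr fun ω hω h => hd ((hδ ω (h₁.1 hω)) ▸ h.1)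
  rcases hsw with H | H
  · refine (s₁.reach_sub (s₁.has_const 0) ((hf.1 0).mono h₁)).mono le_rfl fun s₂ h₂ H₂ => ?_
    refine ⟨⟨1 - δ, fun ω hω => ?_⟩, fun i j => ?_⟩
    · rw [Function.iterate_one, DivState.next, if_pos (H ω (h₂.1 hω)), hδ ω (h₁.1 (h₂.1 hω))]
    · suffices h : s₂.HasPoly 2 fun ω => (!![0, X; C ((t ω).g.coeff 0), -C ((t ω).f.coeff 0)] :
          Matrix (Fin 2) (Fin 2) F[X]) i j from h.congr fun ω hω => by
        beta_reduce
        rw [DivState.trans_one, DivState.stepMatrix, if_pos (H ω (h₂.1 hω))]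
      fin_cases i <;> fin_cases j
      · exact h0 s₂
      · exact hX s₂
      · exact hC ((hg.1 0).mono (h₁.trans h₂))
      · exact (hC H₂).congr fun ω _ => by simp
  · refine (s₁.reach_sub (s₁.has_const 0) ((hg.1 0).mono h₁)).mono le_rfl fun s₂ h₂ H₂ => ?_
    refine ⟨⟨1 + δ, fun ω hω => ?_⟩, fun i j => ?_⟩
    · rw [Function.iterate_one, DivState.next, if_neg (H ω (h₂.1 hω)), hδ ω (h₁.1 (h₂.1 hω))]
    · suffices h : s₂.HasPoly 2 fun ω => (!![X, 0; -C ((t ω).g.coeff 0), C ((t ω).f.coeff 0)] :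
          Matrix (Fin 2) (Fin 2) F[X]) i j from h.congr fun ω hω => by
        beta_reduce
        rw [DivState.trans_one, DivState.stepMatrix, if_neg (H ω (h₂.1 hω))]
      fin_cases i <;> fin_cases j
      · exact hX s₂
      · exact h0 s₂
      · exact (hC H₂).congr fun ω _ => by simp
      · exact hC ((hf.1 0).mono (h₁.trans h₂))

/-- Half-gcd composition: run `m` steps on truncated data, apply their matrix to `f` and `g`, divide
by `X ^ m`, run `n` steps on the truncated result, and multiply the matrices. Applying the matrix
costs `4 * c + 4 * N` and the final product `8 * c + 8 * N`. -/
theorem TransCost.add {m n k l N c : ℕ} (hm : TransCost F m k) (hn : TransCost F n l)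
    (hM : MulCost F N c) (hN : m + n + 1 ≤ N) :
    TransCost F (m + n) (k + l + 12 * c + 12 * N) := by
  constructor
  rintro Ω s t ⟨⟨δ, hδ⟩, hf, hg⟩
  have key : ∀ t : DivState F, (DivState.next^[m] (t.low m)).δ = (DivState.next^[m] t).δ ∧
      DivState.trans m (t.low m) = DivState.trans m t := fun t =>
    (DivState.agree_low le_rfl t).iterate
  refine (hm.reach s (fun ω => (t ω).low m) ⟨⟨δ, hδ⟩, hf.lowPart m, hg.lowPart m⟩).bind
    (m := l + 12 * c + 12 * N) _ (by omega) ?_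
  rintro s₁ h₁ ⟨⟨δ₁, hδ₁⟩, H₁⟩
  simp only [key] at hδ₁ H₁
  have H₁' : s₁.HasMatrix N fun ω => DivState.trans m (t ω) := fun i j => (H₁ i j).le (by omega)
  refine (s₁.reach_fin_two (2 * c + 2 * N) (fun i s' => s'.HasPoly (2 * N) fun ω =>
    DivState.trans m (t ω) i 0 * (t ω).f + DivState.trans m (t ω) i 1 * (t ω).g)
    (fun _ _ _ hs h => h.mono hs) fun i s₂ h₂ =>
      reach_mul_add_mul hM ((H₁' i 0).mono h₂) ((hf.mono (h₁.trans h₂)).le (by omega))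
        ((H₁' i 1).mono h₂) ((hg.mono (h₁.trans h₂)).le (by omega))).bind
    (m := l + 8 * c + 8 * N) _ (by omega) fun s₂ h₂ H₂ => ?_
  have hpow : ∀ p q : F[X], X ^ m * p = q → highPart m q = p := by
    rintro p q rfl
    ext i
    rw [coeff_highPart, coeff_X_pow_mul]
  have hst : s₂.HasState n fun ω => (DivState.next^[m] (t ω)).low n := by
    refine ⟨⟨δ₁, fun ω hω => hδ₁ ω (h₂.1 hω)⟩, ?_, ?_⟩
    · refine (((H₂ 0).highPart m).lowPart n).congr fun ω _ => ?_
      rw [hpow _ _ (DivState.X_pow_mul_iterate m (t ω)).1]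
      rfl
    · refine (((H₂ 1).highPart m).lowPart n).congr fun ω _ => ?_
      rw [hpow _ _ (DivState.X_pow_mul_iterate m (t ω)).2]
      rfl
  have key' : ∀ t : DivState F, (DivState.next^[n] (t.low n)).δ = (DivState.next^[n] t).δ ∧
      DivState.trans n (t.low n) = DivState.trans n t := fun t =>
    (DivState.agree_low le_rfl t).iterate
  refine (hn.reach s₂ _ hst).bind (m := 8 * c + 8 * N) _ (by omega) ?_
  rintro s₃ h₃ ⟨⟨δ₂, hδ₂⟩, H₃⟩
  simp only [key'] at hδ₂ H₃
  refine (reach_matrix_mul hM (fun i j => (H₃ i j).le (by omega))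
    (H₁'.mono (h₂.trans h₃))).mono le_rfl fun s₄ h₄ H₄ => ⟨⟨δ₂, fun ω hω => ?_⟩, fun i j => ?_⟩
  · rw [Nat.add_comm, Function.iterate_add_apply]
    exact hδ₂ ω (h₄.1 hω)
  · refine ((H₄ i j).congr fun ω _ => ?_).of_degree fun ω _ k hk =>
      DivState.coeff_trans _ _ _ _ _ hk
    beta_reduce
    rw [DivState.trans_add]

/-- Bisection of the number of steps. At one level, `c = 16 * M n` and `N = 2 * n` in
`TransCost.add` give at most `(192 + 24) * M n`, and super-linearity sums the two halves. -/
theorem IsMultiplicationTime.transCost {M : ℕ → ℕ} (hM : IsMultiplicationTime F M) {n : ℕ}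
    (hn : 0 < n) : TransCost F n (216 * M n * (Nat.clog 2 n + 1)) := by
  induction n using Nat.strong_induction_on with
  | _ n ih =>
  have hle := hM.le_self n hn
  rcases Nat.lt_or_ge n 2 with hn2 | hn2
  · obtain rfl : n = 1 := by omega
    refine transCost_one.mono ?_
    simp only [Nat.clog_one_right]
    omega
  · have hclog := Nat.clog_of_two_le one_lt_two hn2
    have e : n / 2 + (n + 2 - 1) / 2 = n := by omega
    have h1 := ih (n / 2) (by omega) (by omega)
    have h2 := ih ((n + 2 - 1) / 2) (by omega) (by omega)
    have hadd := hM.add_le (n / 2) ((n + 2 - 1) / 2) (by omega) (by omega)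
    have hmono : Nat.clog 2 (n / 2) ≤ Nat.clog 2 ((n + 2 - 1) / 2) :=
      Nat.clog_mono_right 2 (by omega)
    have h := h1.add h2 (hM.mulCost_two hn) (by omega)
    rw [e] at h hadd
    refine h.mono ?_
    rw [hclog]
    set l := Nat.clog 2 ((n + 2 - 1) / 2)
    calc 216 * M (n / 2) * (Nat.clog 2 (n / 2) + 1) + 216 * M ((n + 2 - 1) / 2) * (l + 1) +
          12 * (16 * M n) + 12 * (2 * n)
        ≤ 216 * M (n / 2) * (l + 1) + 216 * M ((n + 2 - 1) / 2) * (l + 1) +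
          12 * (16 * M n) + 12 * (2 * M n) := by gcongr
      _ = 216 * (M (n / 2) + M ((n + 2 - 1) / 2)) * (l + 1) + 216 * M n := by ring
      _ ≤ 216 * M n * (l + 1) + 216 * M n := by gcongr
      _ = _ := by ring

end

/-! ### Modular inversion by division steps -/

section

variable {F : Type u} [Field F]

/-- The coefficient of `p` at an integer, zero at the negative ones. -/
def intCoeff (p : F[X]) (i : ℤ) : F := if 0 ≤ i then p.coeff i.toNat else 0

theorem intCoeff_natCast (p : F[X]) (i : ℕ) : intCoeff p i = p.coeff i := by
  simp [intCoeff]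

theorem intCoeff_of_neg (p : F[X]) {i : ℤ} (hi : i < 0) : intCoeff p i = 0 := by
  rw [intCoeff, if_neg (by omega)]

theorem intCoeff_sub (p q : F[X]) (i : ℤ) : intCoeff (p - q) i = intCoeff p i - intCoeff q i := by
  unfold intCoeff
  split_ifs <;> simp

theorem intCoeff_C_mul (a : F) (p : F[X]) (i : ℤ) : intCoeff (C a * p) i = a * intCoeff p i := by
  unfold intCoeff
  split_ifs <;> simp

theorem intCoeff_X_pow_mul (j : ℕ) (p : F[X]) (i : ℤ) :
    intCoeff (X ^ j * p) i = intCoeff p (i - j) := by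
  unfold intCoeff
  by_cases h : 0 ≤ i
  · rw [if_pos h, coeff_X_pow_mul']
    by_cases h' : (j : ℤ) ≤ i
    · rw [if_pos (by omega), if_pos (by omega)]
      congr 1
      omega
    · rw [if_neg (by omega), if_neg (by omega)]
  · rw [if_neg h, if_neg (by omega)]

theorem intCoeff_X_mul (p : F[X]) (i : ℤ) : intCoeff (X * p) i = intCoeff p (i - 1) := by
  simpa using intCoeff_X_pow_mul 1 p i

/-- `P` is `x ^ k * p (1 / x)`. -/
def IsReflection (k : ℤ) (p P : F[X]) : Prop := ∀ i, intCoeff p i = intCoeff P (k - i)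

namespace IsReflection

variable {k l : ℤ} {p q P Q : F[X]}

theorem sub (h : IsReflection k p P) (h' : IsReflection k q Q) :
    IsReflection k (p - q) (P - Q) := fun i => by
  rw [intCoeff_sub, intCoeff_sub, h, h']

theorem C_mul (h : IsReflection k p P) (a : F) : IsReflection k (C a * p) (C a * P) := fun i => by
  rw [intCoeff_C_mul, intCoeff_C_mul, h]

theorem zero (k : ℤ) : IsReflection k (0 : F[X]) 0 := fun i => by simp [intCoeff]

theorem X_pow_mul (h : IsReflection k p P) (j : ℕ) (hl : l = k + j) :
    IsReflection l p (X ^ j * P) := fun i => by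
  rw [intCoeff_X_pow_mul, h, hl]
  congr 1
  ring

theorem X_mul_left (h : IsReflection k p P) (hl : l = k + 1) :
    IsReflection l (X * p) P := fun i => by
  rw [intCoeff_X_mul, h, hl]
  congr 1
  ring

theorem of_X_mul (h : IsReflection k (X * p) P) (hl : l = k - 1) :
    IsReflection l p P := fun i => by
  have := h (i + 1)
  rw [intCoeff_X_mul, add_sub_cancel_right] at this
  rw [this, hl]
  congr 1
  ring

theorem reflect (n : ℕ) (hP : ∀ i, n + 1 ≤ i → P.coeff i = 0) :
    IsReflection n (P.reflect n) P := fun i => by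
  by_cases h : 0 ≤ i
  · lift i to ℕ using h
    rw [intCoeff_natCast, coeff_reflect]
    by_cases h' : i ≤ n
    · rw [revAt_le h', ← intCoeff_natCast]
      congr 1
      omega
    · rw [revAt_eq_self_of_lt (by omega), hP i (by omega), intCoeff_of_neg _ (by omega)]
  · rw [intCoeff_of_neg _ (by omega)]
    have : (n : ℤ) - i = ((n - i).toNat : ℕ) := by omega
    rw [this, intCoeff_natCast, hP _ (by omega)]

/-- This detects the end of the algorithm: once the degree bound of the second polynomial is
negative, that polynomial vanishes. -/
theorem eq_zero (h : IsReflection k p P) (hk : k < 0) : P = 0 := by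
  ext i
  have := h (k - i)
  rwa [intCoeff_of_neg _ (by omega), sub_sub_cancel, intCoeff_natCast, eq_comm] at this

theorem nonneg (h : IsReflection k p P) (h0 : p.coeff 0 ≠ 0) : 0 ≤ k := by
  by_contra hk
  have := h 0
  rw [sub_zero, intCoeff_of_neg P (by omega)] at this
  exact h0 (by simpa [intCoeff] using this)

theorem coeff_eq (n : ℕ) (h : IsReflection n p P) (i : ℕ) (hi : i ≤ n) :
    P.coeff i = p.coeff (n - i) := by
  have := h (n - i)
  rw [sub_sub_cancel, intCoeff_natCast] at this
  rw [← this, ← intCoeff_natCast]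
  congr 1
  omega

theorem coeff_eq_zero (n : ℕ) (h : IsReflection n p P) (i : ℕ) (hi : n < i) :
    p.coeff i = 0 ∧ P.coeff i = 0 := by
  have h1 := h i
  have h2 := h (n - i)
  rw [sub_sub_cancel, intCoeff_of_neg _ (by omega), intCoeff_natCast] at h2
  rw [intCoeff_natCast, intCoeff_of_neg _ (by omega)] at h1
  exact ⟨h1, h2.symm⟩

theorem eq_reflect (n : ℕ) (h : IsReflection n p P) : P = p.reflect n := by
  ext i
  rw [coeff_reflect]
  by_cases hi : i ≤ n
  · rw [revAt_le hi, h.coeff_eq n i hi]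
  · rw [revAt_eq_self_of_lt (by omega), (h.coeff_eq_zero n i (by omega)).1,
      (h.coeff_eq_zero n i (by omega)).2]

end IsReflection

/-- The invariant of the division steps that start from the reflections of `T` (of degree `d`) and
`A` (of degree less than `d`): `t` holds the reflections of two coprime polynomials `f`, `g`, of
degree `e` and at most `b`, and `P` the reflections of their cofactors with respect to `T`, `A`. -/
structure DivInvariant (T A : F[X]) (d n : ℕ) (t : DivState F)
    (P : Matrix (Fin 2) (Fin 2) F[X]) (e b : ℤ) (f g u v r s : F[X]) : Prop where
  sub_eq : t.δ = e - b
  add_eq : e + b = 2 * d - 1 - n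
  coeff_f : t.f.coeff 0 ≠ 0
  refl_f : IsReflection e t.f f
  refl_g : IsReflection b t.g g
  eq_f : f = u * T + v * A
  eq_g : g = r * T + s * A
  coprime : IsCoprime f g
  refl_u : IsReflection (d - 1 - b) (P 0 0) u
  refl_v : IsReflection (d - b) (P 0 1) v
  refl_r : IsReflection (d - 1 - e) (P 1 0) r
  refl_s : IsReflection (d - e) (P 1 1) s

/-- Constant coefficients of reflections are coefficients in degrees `e` and `b`. A step cancels the
top terms by subtracting a multiple of the polynomial of smaller degree, shifted by `|e - b|`, and
so lowers `e + b` by one. Since `δ = e - b`, the swap is made exactly when the second polynomial has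
degree exactly `b < e`. Coprimality survives because the polynomial being replaced is scaled by a
nonzero constant. -/
theorem DivInvariant.next {T A : F[X]} {d n : ℕ} {t : DivState F}
    {P : Matrix (Fin 2) (Fin 2) F[X]} {e b : ℤ} {f g u v r s : F[X]}
    (h : DivInvariant T A d n t P e b f g u v r s) :
    ∃ e' b' f' g' u' v' r' s',
      DivInvariant T A d (n + 1) t.next (t.stepMatrix * P) e' b' f' g' u' v' r' s' := by
  obtain ⟨hδ, hn, hf0, hf, hg, ef, eg, ⟨x, y, hxy⟩, hu, hv, hr, hs⟩ := h
  by_cases hsw : t.Swaps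
  · obtain ⟨h1, h2⟩ := hsw
    obtain ⟨j, hj⟩ : ∃ j : ℕ, (j : ℤ) = e - b := ⟨(e - b).toNat, by omega⟩
    have hstep : t.stepMatrix = !![0, X; C (t.g.coeff 0), -C (t.f.coeff 0)] := by
      rw [DivState.stepMatrix, if_pos ⟨h1, h2⟩]
    have hnext := DivState.X_mul_next_g t
    have hnδ : t.next.δ = 1 - t.δ := by rw [DivState.next, if_pos ⟨h1, h2⟩]
    have hnf : t.next.f = t.g := by rw [DivState.next, if_pos ⟨h1, h2⟩]
    rw [hstep] at hnext
    set g₀ := t.g.coeff 0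
    set f₀ := t.f.coeff 0
    refine ⟨b, e - 1, g, C g₀ * f - C f₀ * (X ^ j * g), r, s, C g₀ * u - C f₀ * (X ^ j * r),
      C g₀ * v - C f₀ * (X ^ j * s), ?_, ?_, ?_, ?_, ?_, eg, ?_, ?_, ?_, ?_, ?_, ?_⟩
    · rw [hnδ]; omega
    · push_cast; omega
    · rw [hnf]; exact h2
    · rw [hnf]; exact hg
    · refine IsReflection.of_X_mul (k := e) ?_ rfl
      rw [hnext]
      have := (hf.C_mul g₀).sub ((hg.X_pow_mul (l := e) j (by omega)).C_mul f₀)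
      simpa [sub_eq_add_neg] using this
    · rw [ef, eg]; ring
    · have hc : C g₀ * C g₀⁻¹ = (1 : F[X]) := by rw [← C_mul, mul_inv_cancel₀ h2, C_1]
      exact ⟨y + x * C g₀⁻¹ * C f₀ * X ^ j, x * C g₀⁻¹, by linear_combination hxy + x * f * hc⟩
    · rw [hstep]
      simpa [Matrix.mul_apply, Fin.sum_univ_two] using hr.X_mul_left (by ring)
    · rw [hstep]
      simpa [Matrix.mul_apply, Fin.sum_univ_two] using hs.X_mul_left (by ring)
    · rw [hstep]
      have := (hu.C_mul g₀).sub ((hr.X_pow_mul (l := d - 1 - b) j (by omega)).C_mul f₀)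
      simpa [Matrix.mul_apply, Fin.sum_univ_two, sub_eq_add_neg] using this
    · rw [hstep]
      have := (hv.C_mul g₀).sub ((hs.X_pow_mul (l := d - b) j (by omega)).C_mul f₀)
      simpa [Matrix.mul_apply, Fin.sum_univ_two, sub_eq_add_neg] using this
  · have hstep : t.stepMatrix = !![X, 0; -C (t.g.coeff 0), C (t.f.coeff 0)] := by
      rw [DivState.stepMatrix, if_neg hsw]
    have hnext := DivState.X_mul_next_g t
    have hnδ : t.next.δ = 1 + t.δ := by rw [DivState.next, if_neg hsw]
    have hnf : t.next.f = t.f := by rw [DivState.next, if_neg hsw]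
    rw [hstep] at hnext
    -- If `g` has zero constant coefficient, `b - e` may be negative, but nothing is subtracted and
    -- `j = 0` is a dummy. Otherwise the absence of a swap gives `e ≤ b`.
    obtain ⟨j, hj⟩ : ∃ j : ℕ, ∀ (k l : ℤ) (p P : F[X]), l = k + (b - e) → IsReflection k p P →
        IsReflection l (C (t.g.coeff 0) * p) (C (t.g.coeff 0) * (X ^ j * P)) := by
      by_cases h0 : t.g.coeff 0 = 0
      · exact ⟨0, fun k l p P _ _ => by simpa [h0] using IsReflection.zero l⟩
      · have : ¬ 0 < t.δ := fun h => hsw ⟨h, h0⟩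
        exact ⟨(b - e).toNat, fun k l p P hl h => (h.X_pow_mul _ (by omega)).C_mul _⟩
    set g₀ := t.g.coeff 0
    set f₀ := t.f.coeff 0
    refine ⟨e, b - 1, f, C f₀ * g - C g₀ * (X ^ j * f), u, v, C f₀ * r - C g₀ * (X ^ j * u),
      C f₀ * s - C g₀ * (X ^ j * v), ?_, ?_, ?_, ?_, ?_, ef, ?_, ?_, ?_, ?_, ?_, ?_⟩
    · rw [hnδ]; omega
    · push_cast; omega
    · rw [hnf]; exact hf0
    · rw [hnf]; exact hf
    · refine IsReflection.of_X_mul (k := b) ?_ rfl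
      rw [hnext]
      have := (hg.C_mul f₀).sub (hj e b _ _ (by ring) hf)
      simpa [sub_eq_add_neg, add_comm] using this
    · rw [ef, eg]; ring
    · have hc : C f₀ * C f₀⁻¹ = (1 : F[X]) := by rw [← C_mul, mul_inv_cancel₀ hf0, C_1]
      exact ⟨x + y * C f₀⁻¹ * C g₀ * X ^ j, y * C f₀⁻¹, by linear_combination hxy + y * g * hc⟩
    · rw [hstep]
      simpa [Matrix.mul_apply, Fin.sum_univ_two] using hu.X_mul_left (by ring)
    · rw [hstep]
      simpa [Matrix.mul_apply, Fin.sum_univ_two] using hv.X_mul_left (by ring)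
    · rw [hstep]
      have := (hr.C_mul f₀).sub (hj (d - 1 - b) (d - 1 - e) _ _ (by ring) hu)
      simpa [Matrix.mul_apply, Fin.sum_univ_two, sub_eq_add_neg, add_comm] using this
    · rw [hstep]
      have := (hs.C_mul f₀).sub (hj (d - b) (d - e) _ _ (by ring) hv)
      simpa [Matrix.mul_apply, Fin.sum_univ_two, sub_eq_add_neg, add_comm] using this

/-- The initial state for inverting `A` modulo `T`. -/
noncomputable def initState (d : ℕ) (T A : F[X]) : DivState F :=
  ⟨1, T.reflect d, A.reflect (d - 1)⟩

theorem exists_divInvariant {T A : F[X]} {d : ℕ} (hd : 0 < d) (hT : T.Monic)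
    (hTd : T.natDegree = d) (hA : ∀ i, d ≤ i → A.coeff i = 0) (hTA : IsCoprime T A) (n : ℕ) :
    ∃ e b f g u v r s, DivInvariant T A d n (DivState.next^[n] (initState d T A))
      (DivState.trans n (initState d T A)) e b f g u v r s := by
  induction n with
  | zero =>
    have h00 : ∀ k : ℤ, k = 0 → IsReflection k (1 : F[X]) 1 := by
      rintro k rfl
      have := IsReflection.reflect (P := (1 : F[X])) 0 fun i hi => by
        rw [← C_1, coeff_C, if_neg (by omega)]
      simpa using this
    refine ⟨d, d - 1, T, A, 1, 0, 0, 1, ?_, ?_, ?_, ?_, ?_, ?_, ?_, hTA, ?_, ?_, ?_, ?_⟩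
    · simp [initState]
    · push_cast; ring
    · simp only [initState, Function.iterate_zero, id, coeff_reflect]
      rw [revAt_le (Nat.zero_le _), Nat.sub_zero, ← hTd]
      exact hT.coeff_natDegree.symm ▸ one_ne_zero
    · exact IsReflection.reflect d fun i hi => coeff_eq_zero_of_natDegree_lt (by omega)
    · have := IsReflection.reflect (P := A) (d - 1) fun i hi => hA i (by omega)
      rwa [Nat.cast_sub hd, Nat.cast_one] at this
    · ring
    · ring
    · exact h00 _ (by ring)
    · exact IsReflection.zero _
    · exact IsReflection.zero _
    · exact h00 _ (by ring)
  | succ n ih =>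
    obtain ⟨e, b, f, g, u, v, r, s, h⟩ := ih
    rw [DivState.trans_add n 1, DivState.trans_one, Function.iterate_succ_apply']
    exact h.next

/-- After `2 * d` steps `e + b = -1`. As `e ≥ 0`, the bound `b` is negative and `g = 0`; by
coprimality `f` is a nonzero constant, whence `e = 0` and `b = -1`. The first row of the matrix then
holds the reflected Bézout cofactors, of orders `d` and `d + 1`. -/
theorem trans_initState_bezout {T A : F[X]} {d : ℕ} (hd : 0 < d) (hT : T.Monic)
    (hTd : T.natDegree = d) (hA : ∀ i, d ≤ i → A.coeff i = 0) (hTA : IsCoprime T A) :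
    ∃ c ≠ 0, (DivState.trans (2 * d) (initState d T A) 0 0).reflect d * T +
        (DivState.trans (2 * d) (initState d T A) 0 1).reflect (d + 1) * A = C c ∧
      ∀ i, d + 2 ≤ i → (DivState.trans (2 * d) (initState d T A) 0 1).coeff i = 0 := by
  obtain ⟨e, b, f, g, u, v, r, s, h⟩ := exists_divInvariant hd hT hTd hA hTA (2 * d)
  have he := h.refl_f.nonneg h.coeff_f
  have hn := h.add_eq
  push_cast at hn
  have hg := h.refl_g.eq_zero (by omega)
  have hu := h.coprime
  rw [hg, isCoprime_zero_right, Polynomial.isUnit_iff] at hu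
  obtain ⟨c, hc, rfl⟩ := hu
  have he0 : e = 0 := by
    by_contra hne
    have h0 := h.refl_f 0
    have : intCoeff (C c) (e - 0) = 0 := by
      rw [sub_zero, intCoeff, if_pos he, coeff_C, if_neg (by omega)]
    rw [this] at h0
    exact h.coeff_f (by simpa [intCoeff] using h0)
  obtain rfl : b = -1 := by omega
  have hu : IsReflection (d : ℕ)
      (DivState.trans (2 * d) (initState d T A) 0 0) u := by simpa using h.refl_u
  have hv : IsReflection (d + 1 : ℕ)
      (DivState.trans (2 * d) (initState d T A) 0 1) v := by simpa using h.refl_v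
  refine ⟨c, hc.ne_zero, ?_, fun i hi => (hv.coeff_eq_zero _ i (by omega)).1⟩
  rw [← hu.eq_reflect, ← hv.eq_reflect]
  exact h.eq_f.symm

end

/-! ### Cost of modular inversion. -/

namespace Stage

variable {F Ω : Type u} [Field F]

theorem reach_inverse_mod {M : ℕ → ℕ} (hM : IsMultiplicationTime F M) {d : ℕ} (hd : 0 < d)
    {s : Stage Ω F} {T A : Ω → F[X]} (hT : s.HasPoly (d + 1) T) (hA : s.HasPoly d A)
    (hT1 : ∀ ω ∈ s.inputs, (T ω).Monic) (hTd : ∀ ω ∈ s.inputs, (T ω).natDegree = d)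
    (hTA : ∀ ω ∈ s.inputs, IsCoprime (T ω) (A ω)) :
    Reach (fun s' => ∃ V, s'.HasPoly (d + 2) V ∧ ∀ ω ∈ s'.inputs, T ω ∣ V ω * A ω - 1)
      (1542 * M d * (Nat.clog 2 d + 1)) s := by
  have hle := hM.le_self d hd
  -- The `2 * d` steps are done as `d + d`, with products of length `4 * d` split twice, so that
  -- only `M d` occurs.
  have hcost : TransCost F (2 * d) (432 * M d * (Nat.clog 2 d + 1) + 1104 * M d) := by
    have h := (hM.transCost hd).add (hM.transCost hd) (hM.mulCost_two hd).double (by omega)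
    rw [← two_mul] at h
    refine h.mono ?_
    ring_nf
    omega
  have hst : s.HasState (2 * d) fun ω => initState d (T ω) (A ω) :=
    ⟨⟨1, fun _ _ => rfl⟩, hT.reflect.le (by omega),
      (HasPoly.reflect (n := d - 1) (hA.le (by omega))).le (by omega)⟩
  have hbound : 432 * M d * (Nat.clog 2 d + 1) + 1104 * M d + (3 + (d + 2)) ≤
      1542 * M d * (Nat.clog 2 d + 1) := by
    have : 0 ≤ M d * Nat.clog 2 d := Nat.zero_le _
    ring_nf
    omega
  refine (hcost.reach s _ hst).bind (m := 3 + (d + 2)) _ hbound ?_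
  rintro s₁ h₁ ⟨-, H₁⟩
  choose! c hc0 hc hcd using fun ω hω =>
    trans_initState_bezout hd (hT1 ω hω) (hTd ω hω) (hA.2 ω hω) (hTA ω hω)
  have hV : s₁.HasPoly (d + 2) fun ω =>
      (DivState.trans (2 * d) (initState d (T ω) (A ω)) 0 1).reflect (d + 1) :=
    HasPoly.reflect ((H₁ 0 1).of_degree fun ω hω => hcd ω (h₁.1 hω))
  have hU : s₁.Has fun ω =>
      ((DivState.trans (2 * d) (initState d (T ω) (A ω)) 0 0).reflect d).coeff 0 :=
    ((H₁ 0 0).1 d).congr fun ω _ => by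
      rw [coeff_reflect, revAt_le (Nat.zero_le _), Nat.sub_zero]
  generalize hVd : (fun ω => (DivState.trans (2 * d) (initState d (T ω) (A ω)) 0 1).reflect (d + 1))
    = V at hV
  generalize hUd : (fun ω => (DivState.trans (2 * d) (initState d (T ω) (A ω)) 0 0).reflect d)
    = U
  have hU' : s₁.Has fun ω => (U ω).coeff 0 := by rw [← hUd]; exact hU
  have hUV : ∀ ω ∈ s.inputs, U ω * T ω + V ω * A ω = C (c ω) := by
    rw [← hUd, ← hVd]; exact hc
  -- The Bézout constant is recovered by evaluating the identity at `0`, in three operations.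
  refine (s₁.reach_mul hU' ((hT.1 0).mono h₁)).bind (m := 2 + (d + 2)) _ (by omega)
    fun s₂ h₂ H₂ => ?_
  refine (s₂.reach_mul ((hV.1 0).mono h₂) ((hA.1 0).mono (h₁.trans h₂))).bind
    (m := 1 + (d + 2)) _ (by omega) fun s₃ h₃ H₃ => ?_
  refine (s₃.reach_add (H₂.mono h₃) H₃).bind (m := d + 2) _ (by omega) fun s₄ h₄ H₄ => ?_
  have h₄' := h₁.trans (h₂.trans (h₃.trans h₄))
  have hcs : s₄.Has c := H₄.congr fun ω hω => by
    have := congrArg (fun p => coeff p 0) (hUV ω (h₄'.1 hω))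
    simpa [mul_coeff_zero] using this
  refine (s₄.reach_poly (d + 2) (fun ω => C (c ω)⁻¹ * V ω) 1 (fun i _ s' h => ?_)
    fun ω hω i hi => ?_).mono (by omega) fun s₅ h₅ H₅ => ⟨_, H₅, fun ω hω => ?_⟩
  · refine (s'.reach_div ((hV.1 i).mono ((h₂.trans (h₃.trans h₄)).trans h)) (hcs.mono h)
      fun ω hω => hc0 ω ((h₄'.trans h).1 hω)).mono le_rfl fun s'' _ H => H.congr fun ω _ => ?_
    rw [coeff_C_mul, div_eq_inv_mul]
  · rw [coeff_C_mul, hV.2 ω ((h₂.trans (h₃.trans h₄)).1 hω) i hi, mul_zero]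
  · have hω' := (h₄'.trans h₅).1 hω
    have hcc : C (c ω)⁻¹ * C (c ω) = (1 : F[X]) := by
      rw [← C_mul, inv_mul_cancel₀ (hc0 ω hω'), C_1]
    exact ⟨-C (c ω)⁻¹ * U ω, by linear_combination C (c ω)⁻¹ * hUV ω hω' + hcc⟩

end Stage

/-! ### Derivatives of rational functions whose denominator is a power of `T` -/

section CommRing

variable {R : Type u} [CommRing R]

/-- The numerator over `T ^ (e + 1)` of the opposite of the derivative of `P / T ^ e`. -/
noncomputable def derivNum (T : R[X]) (e : ℕ) (P : R[X]) : R[X] :=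
  (e : R[X]) * P * derivative T - derivative P * T

/-- The numerator over `T ^ (e + m)` of `(-1) ^ m` times the `m`-th derivative of `P / T ^ e`. -/
noncomputable def derivNumIter (T : R[X]) (e : ℕ) : ℕ → R[X] → R[X]
  | 0, P => P
  | m + 1, P => derivNum T (e + m) (derivNumIter T e m P)

/-- The numerator over `T ^ n` of the sum of the `(-1) ^ k` times the `k`-th derivatives of
`c k / T`, for `k < n`. -/
noncomputable def derivSum (T : R[X]) (n : ℕ) (c : ℕ → R[X]) : R[X] :=
  ∑ k ∈ Finset.range n, T ^ (n - 1 - k) * derivNumIter T 1 k (c k)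

theorem derivNumIter_add (T : R[X]) (e m k : ℕ) (P : R[X]) :
    derivNumIter T e (m + k) P = derivNumIter T (e + m) k (derivNumIter T e m P) := by
  induction k with
  | zero => rfl
  | succ k ih => rw [← add_assoc, derivNumIter, ih, derivNumIter, add_assoc]

/-- The fraction `P / T ^ e` is here written over `T ^ (e + j)`; its derivatives do not change, so
their numerators only gain the factor `T ^ j`. -/
theorem derivNumIter_pow_mul (T : R[X]) (e m j : ℕ) (P : R[X]) :
    derivNumIter T (e + j) m (T ^ j * P) = T ^ j * derivNumIter T e m P := by
  induction m with
  | zero => rfl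
  | succ m ih =>
    rw [derivNumIter, ih, derivNumIter]
    generalize derivNumIter T e m P = Q
    have h : T * derivative (T ^ j) = (j : R[X]) * T ^ j * derivative T := by
      cases j with
      | zero => simp
      | succ j =>
        rw [derivative_pow_succ]
        simp only [map_add, map_natCast, map_one]
        push_cast
        ring
    unfold derivNum
    rw [derivative_mul]
    push_cast
    linear_combination -Q * h

theorem derivNumIter_sum {ι : Type} (T : R[X]) (e m : ℕ) (s : Finset ι) (f : ι → R[X]) :
    derivNumIter T e m (∑ i ∈ s, f i) = ∑ i ∈ s, derivNumIter T e m (f i) := by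
  induction m with
  | zero => rfl
  | succ m ih =>
    simp only [derivNumIter, derivNum, ih, derivative_sum, Finset.mul_sum, Finset.sum_mul,
      Finset.sum_sub_distrib]

/-- The terms of order at least `m` are together the `m`-th derivative of a shorter sum of the same
kind; this is the divide-and-conquer step. -/
theorem derivSum_add (T : R[X]) (m n : ℕ) (c : ℕ → R[X]) :
    derivSum T (m + n) c = T ^ n * derivSum T m c +
      derivNumIter T n m (derivSum T n fun k => c (m + k)) := by
  simp only [derivSum]
  rw [Finset.sum_range_add, derivNumIter_sum, Finset.mul_sum]
  congr 1
  · refine Finset.sum_congr rfl fun k hk => ?_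
    rw [Finset.mem_range] at hk
    rw [← mul_assoc, ← pow_add]
    congr 2
    omega
  · refine Finset.sum_congr rfl fun k hk => ?_
    rw [Finset.mem_range] at hk
    have h := derivNumIter_pow_mul T (1 + k) m (n - 1 - k) (derivNumIter T 1 k (c (m + k)))
    rw [show 1 + k + (n - 1 - k) = n by omega] at h
    rw [h, ← derivNumIter_add, add_comm k m]
    congr 2
    omega

theorem map_derivNumIter {S : Type u} [CommRing S] (φ : R →+* S) (T : R[X]) (e m : ℕ) (P : R[X]) :
    (derivNumIter T e m P).map φ = derivNumIter (T.map φ) e m (P.map φ) := by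
  induction m with
  | zero => rfl
  | succ m ih => simp [derivNumIter, derivNum, ← ih, Polynomial.derivative_map]

theorem map_derivSum {S : Type u} [CommRing S] (φ : R →+* S) (T : R[X]) (n : ℕ) (c : ℕ → R[X]) :
    (derivSum T n c).map φ = derivSum (T.map φ) n fun k => (c k).map φ := by
  simp [derivSum, Polynomial.map_sum, map_derivNumIter]

/-- The principal part of the derivatives of `P / T` at a root `a` of `T`. -/
theorem pow_dvd_derivNumIter_sub {U P : R[X]} {a l : R} (h : X - C a ∣ P - C l * U) (k : ℕ) :
    (X - C a) ^ (k + 1) ∣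
      derivNumIter ((X - C a) * U) 1 k P - C (k.factorial * l) * U ^ (k + 1) := by
  induction k with
  | zero => simpa [derivNumIter] using h
  | succ k ih =>
    obtain ⟨Q, hQ⟩ := ih
    rw [sub_eq_iff_eq_add] at hQ
    rw [derivNumIter, hQ]
    -- This is the numerator over `U ^ (k + 2)` of the opposite of the derivative of the regular
    -- part `Q / U ^ (k + 1)`.
    refine ⟨((k + 1 : ℕ) : R[X]) * Q * derivative U - derivative Q * U, ?_⟩
    have h1 : derivative (U ^ (k + 1)) = ((k + 1 : ℕ) : R[X]) * U ^ k * derivative U := by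
      rw [derivative_pow_succ]; simp
    have h2 : derivative ((X - C a) ^ (k + 1)) = ((k + 1 : ℕ) : R[X]) * (X - C a) ^ k := by
      rw [derivative_pow_succ]; simp
    unfold derivNum
    rw [derivative_add, derivative_mul, derivative_mul, derivative_mul, h1, h2, Nat.factorial_succ]
    simp only [derivative_sub, derivative_X, derivative_C]
    simp only [map_mul, map_natCast]
    push_cast
    ring

/-- Modulo `T`, the operator `derivNum T e` is multiplication by `e * derivative T`, and `e` runs
from `1` to `k`. -/
theorem dvd_derivNumIter_sub (T P : R[X]) (k : ℕ) :
    T ∣ derivNumIter T 1 k P - (k.factorial : R[X]) * derivative T ^ k * P := by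
  induction k with
  | zero => simp [derivNumIter]
  | succ k ih =>
    obtain ⟨Q, hQ⟩ := ih
    rw [derivNumIter, Nat.factorial_succ]
    refine ⟨((1 + k : ℕ) : R[X]) * derivative T * Q - derivative (derivNumIter T 1 k P), ?_⟩
    unfold derivNum
    push_cast
    linear_combination (1 + k : R[X]) * derivative T * hQ

theorem dvd_derivSum_sub (T : R[X]) (n : ℕ) (c : ℕ → R[X]) :
    T ∣ derivSum T (n + 1) c - (n.factorial : R[X]) * derivative T ^ n * c n := by
  rw [derivSum, Finset.sum_range_succ, add_sub_assoc]
  refine dvd_add (Finset.dvd_sum fun k hk => ?_) ?_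
  · rw [Finset.mem_range] at hk
    exact Dvd.dvd.mul_right (dvd_pow_self T (by omega)) _
  · simpa using dvd_derivNumIter_sub T (c n) n

/-- The numerator over `X ^ (N + m)` of `(-1) ^ m` times the `m`-th derivative of `Q / X ^ N`. -/
noncomputable def scaleIter (N : ℕ) : ℕ → R[X] → R[X]
  | 0, Q => Q
  | m + 1, Q => ((N + m : ℕ) : R[X]) * scaleIter N m Q - X * derivative (scaleIter N m Q)

theorem coeff_X_mul_derivative (p : R[X]) (j : ℕ) :
    (X * derivative p).coeff j = (j : R) * p.coeff j := by
  cases j with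
  | zero => simp
  | succ j => rw [coeff_X_mul, coeff_derivative]; push_cast; ring

/-- Differentiation is diagonal on the powers `x ^ (j - N)`. The factors depend on the indices only,
hence are free constants for the algorithm. -/
theorem coeff_scaleIter (N m : ℕ) (Q : R[X]) (j : ℕ) :
    (scaleIter N m Q).coeff j =
      (∏ i ∈ Finset.range m, (((N + i : ℕ) : R) - (j : R))) * Q.coeff j := by
  induction m with
  | zero => simp [scaleIter]
  | succ m ih =>
    rw [scaleIter, coeff_sub, ← C_eq_natCast, coeff_C_mul, ih, Finset.prod_range_succ]
    rw [coeff_X_mul_derivative, ih]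
    ring

end CommRing

/-! ### Degree bounds and expansions at infinity. -/

section

variable {F : Type u} [Field F]

theorem coeff_derivative_mul_eq_zero {P Q : F[X]} {n m : ℕ} (hP : ∀ i, n ≤ i → P.coeff i = 0)
    (hQ : ∀ i, m + 1 ≤ i → Q.coeff i = 0) (i : ℕ) (hi : n + m ≤ i) :
    (derivative P * Q).coeff i = 0 := by
  rcases Nat.eq_zero_or_pos n with rfl | hn
  · obtain rfl : P = 0 := by
      ext i
      exact hP i (Nat.zero_le i)
    simp
  · refine coeff_mul_eq_zero_of_le (n := n - 1) (m := m + 1) (fun j hj => ?_) hQ i (by omega)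
    rw [coeff_derivative, hP _ (by omega), zero_mul]

theorem coeff_mul_derivative_eq_zero {P T : F[X]} {n d : ℕ} (hP : ∀ i, n ≤ i → P.coeff i = 0)
    (hT : ∀ i, d + 1 ≤ i → T.coeff i = 0) (i : ℕ) (hi : n + d ≤ i + 1) :
    (P * derivative T).coeff i = 0 :=
  coeff_mul_eq_zero_of_le hP (m := d)
    (fun j hj => by rw [coeff_derivative, hT _ (by omega), zero_mul]) i hi

theorem coeff_derivNumIter {T P : F[X]} {d e : ℕ} (hT : ∀ i, d + 1 ≤ i → T.coeff i = 0)
    (hP : ∀ i, d * e ≤ i → P.coeff i = 0) (m i : ℕ) (hi : d * (e + m) ≤ i) :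
    (derivNumIter T e m P).coeff i = 0 := by
  induction m generalizing i with
  | zero => exact hP i hi
  | succ m ih =>
    have hi' : d * (e + m) + d ≤ i := by rw [← add_assoc, mul_add, mul_one] at hi; exact hi
    rw [derivNumIter, derivNum, coeff_sub, mul_assoc, ← C_eq_natCast, coeff_C_mul,
      coeff_mul_derivative_eq_zero ih hT i (by omega),
      coeff_derivative_mul_eq_zero ih hT i hi', mul_zero, sub_zero]

theorem coeff_pow_eq_zero {T : F[X]} {d : ℕ} (hT : ∀ i, d + 1 ≤ i → T.coeff i = 0) (n i : ℕ)
    (hi : d * n + 1 ≤ i) : (T ^ n).coeff i = 0 := by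
  refine coeff_eq_zero_of_natDegree_lt ?_
  have := natDegree_pow_le_of_le n (natDegree_le_of_coeff hT)
  rw [mul_comm] at this
  omega

/-- The relation `P / T ^ e = Q / X ^ N + r / (X ^ N * T ^ e)` is differentiated `m` times. The
error term keeps a numerator of degree less than that of the power of `T` in its denominator. -/
theorem X_pow_mul_derivNumIter {T P Q r : F[X]} {d e N : ℕ}
    (hT : ∀ i, d + 1 ≤ i → T.coeff i = 0) (h : X ^ N * P = Q * T ^ e + r)
    (hr : ∀ i, d * e ≤ i → r.coeff i = 0) (m : ℕ) :
    ∃ r', X ^ (N + m) * derivNumIter T e m P = scaleIter N m Q * T ^ (e + m) + r' ∧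
      ∀ i, d * (e + m) ≤ i → r'.coeff i = 0 := by
  induction m with
  | zero => exact ⟨r, h, hr⟩
  | succ m ih =>
    obtain ⟨r, h, hr⟩ := ih
    rw [derivNumIter, scaleIter, ← add_assoc, ← add_assoc]
    generalize derivNumIter T e m P = P at *
    generalize scaleIter N m Q = Q at *
    generalize N + m = N at *
    generalize e + m = e at *
    -- The new remainder is the numerator over `X ^ (N + 1) * T ^ (e + 1)` of the opposite of the
    -- derivative of `r / (X ^ N * T ^ e)`.
    refine ⟨C (e : F) * (r * (X * derivative T)) - X * derivative r * T + C (N : F) * (T * r),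
      ?_, fun i hi => ?_⟩
    · have hX : X * derivative (X ^ N : F[X]) = (N : F[X]) * X ^ N := by
        cases N with
        | zero => simp
        | succ N => rw [derivative_X_pow]; simp; ring
      have hTe : T * derivative (T ^ e) = (e : F[X]) * T ^ e * derivative T := by
        cases e with
        | zero => simp
        | succ e => rw [derivative_pow_succ]; simp; ring
      have hD := congrArg derivative h
      rw [derivative_mul, derivative_add, derivative_mul] at hD
      unfold derivNum
      simp only [C_eq_natCast]
      linear_combination ((e : F[X]) * X * derivative T + (N : F[X]) * T) * h - X * T * hD +
        T * P * hX - X * Q * hTe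
    · rw [mul_add, mul_one] at hi
      have h1 : ∀ j, d + 1 ≤ j → (X * derivative T).coeff j = 0 := fun j hj => by
        rw [coeff_X_mul_derivative, hT j hj, mul_zero]
      have h2 : ∀ j, d * e ≤ j → (X * derivative r).coeff j = 0 := fun j hj => by
        rw [coeff_X_mul_derivative, hr j hj, mul_zero]
      rw [coeff_add, coeff_sub, coeff_C_mul, coeff_C_mul,
        coeff_mul_eq_zero_of_le hr h1 i (by omega), coeff_mul_eq_zero_of_le h2 hT i (by omega),
        coeff_mul_eq_zero_of_le hT hr i (by omega), mul_zero, mul_zero, sub_zero, add_zero]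

/-- The remainder has degree less than `d * (e + m) ≤ N + m`, so dropping the `N + m` lowest
coefficients removes it. -/
theorem derivNumIter_eq_highPart {T P : F[X]} {d e N m : ℕ} (hT1 : T.Monic)
    (hT : T.natDegree = d) (hN : d * (e + m) ≤ N + m) :
    derivNumIter T e m P =
      highPart (N + m) (scaleIter N m ((X ^ N * P) /ₘ T ^ e) * T ^ (e + m)) := by
  have hTe := hT1.pow e
  have hr : ∀ i, d * e ≤ i → ((X ^ N * P) %ₘ T ^ e).coeff i = 0 := by
    have := degree_modByMonic_lt (X ^ N * P) hTe
    rw [degree_eq_natDegree hTe.ne_zero, natDegree_pow, hT, mul_comm e,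
      degree_lt_iff_coeff_zero] at this
    exact this
  obtain ⟨r', h, hr'⟩ := X_pow_mul_derivNumIter (d := d) (N := N) (e := e) (T := T) (P := P)
    (fun i hi => coeff_eq_zero_of_natDegree_lt (by omega))
    (by rw [add_comm, mul_comm (_ /ₘ _)]; exact (modByMonic_add_div _ _).symm) hr m
  ext i
  have := congrArg (fun p => p.coeff (i + (N + m))) h
  simp only [coeff_X_pow_mul, coeff_add] at this
  rw [coeff_highPart, this, hr' _ (by omega), add_zero]

end

/-! ### Tangling by sums of derivatives -/

section

variable {F : Type u} [Field F]

/-- The coefficient of `ξ ^ j` in `∑ g (i, j) * α ^ i * ξ ^ j`, as a polynomial in `α`. -/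
noncomputable def xiCoeff {d μ : ℕ} (g : Fin d × Fin μ → F) (j : ℕ) : F[X] :=
  if h : j < μ then polyOfCoeffs fun i => g (i, ⟨j, h⟩) else 0

theorem TruncAlg.ofCoeffs_eq (T : F[X]) {d μ : ℕ} (g : Fin d × Fin μ → F) :
    TruncAlg.ofCoeffs T g = ∑ j ∈ Finset.range μ,
      AdjoinRoot.of _ (AdjoinRoot.mk T (xiCoeff g j)) * TruncAlg.xi T μ ^ j := by
  rw [Finset.sum_range, TruncAlg.ofCoeffs, Fintype.sum_prod_type_right]
  refine Finset.sum_congr rfl fun j _ => ?_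
  rw [xiCoeff, dif_pos j.2, polyOfCoeffs, map_sum, map_sum, Finset.sum_mul]
  refine Finset.sum_congr rfl fun i _ => ?_
  rw [map_mul, map_mul, map_pow, map_pow, AdjoinRoot.mk_X, AdjoinRoot.mk_C, Algebra.smul_def,
    mul_assoc]
  rfl

theorem untanglingHom_mk (T : F[X]) (μ : ℕ) (P : F[X]) :
    untanglingHom T μ (AdjoinRoot.mk _ P) =
      AdjoinRoot.mk _ ((P.map (AdjoinRoot.of T)).comp (X + C (AdjoinRoot.root T))) := by
  rw [← TruncAlg.aeval_xi_add_alpha]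
  rfl

theorem exists_root_factor {T : F[X]} (hT : T.Separable) :
    ∃ U : (AdjoinRoot T)[X], T.map (AdjoinRoot.of T) = (X - C (AdjoinRoot.root T)) * U ∧
      IsUnit (U.eval (AdjoinRoot.root T)) := by
  obtain ⟨U, hU⟩ := dvd_iff_isRoot.mpr (AdjoinRoot.isRoot_root T)
  refine ⟨U, hU, ?_⟩
  have h1 : (derivative (T.map (AdjoinRoot.of T))).eval (AdjoinRoot.root T) =
      U.eval (AdjoinRoot.root T) := by
    rw [hU]; simp [derivative_mul]
  obtain ⟨a, b, hab⟩ := hT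
  have h2 := congrArg (AdjoinRoot.mk T) hab
  rw [map_add, map_mul, map_mul, AdjoinRoot.mk_self, mul_zero, zero_add, map_one] at h2
  rw [← h1, derivative_map, eval_map, ← AdjoinRoot.algebraMap_eq, ← aeval_def, AdjoinRoot.aeval_eq]
  exact IsUnit.of_mul_eq_one _ (by rw [mul_comm]; exact h2)

/-- The coefficient polynomials whose `derivSum` is, up to a fixed unit, the tangling of
`∑ g (i, j) * α ^ i * ξ ^ j`. -/
noncomputable def scaledCoeff {d μ : ℕ} (g : Fin d × Fin μ → F) (k : ℕ) : F[X] :=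
  C ((k.factorial : F)⁻¹) * xiCoeff g (μ - 1 - k)

/-- Multiplying the principal parts at the root `α` by `T ^ μ = (X - α) ^ μ * U ^ μ` turns a pole of
order `k + 1` into `ξ ^ (μ - 1 - k)`, and the regular parts vanish modulo `ξ ^ μ`. The factor `w`
comes before `g`, so that it can be eliminated by comparison with the element `1`. -/
theorem untanglingHom_derivSum {T : F[X]} (hT : T.Separable) {μ : ℕ}
    (hμ : ∀ k < μ, (k.factorial : F) ≠ 0) :
    ∃ w : TruncAlg T μ, ∀ {d : ℕ} (g : Fin d × Fin μ → F),
      untanglingHom T μ (AdjoinRoot.mk _ (derivSum T μ (scaledCoeff g))) =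
        w * TruncAlg.ofCoeffs T g := by
  obtain ⟨U, hU, ⟨u, hu⟩⟩ := exists_root_factor hT
  set a := AdjoinRoot.root T with ha
  let v : AdjoinRoot T := ↑u⁻¹
  have huv : v * U.eval a = 1 := by rw [← hu]; exact u.inv_mul
  refine ⟨AdjoinRoot.mk _ ((U ^ μ * C v).comp (X + C a)), fun g => ?_⟩
  have key : (X - C a) ^ μ ∣ (derivSum T μ (scaledCoeff g)).map (AdjoinRoot.of T) -
      U ^ μ * C v * ∑ j ∈ Finset.range μ, C (AdjoinRoot.mk T (xiCoeff g j)) * (X - C a) ^ j := by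
    -- Reversing one sum matches the `k`-th derivative with the power `μ - 1 - k`.
    rw [map_derivSum, hU, derivSum, Finset.mul_sum,
      ← Finset.sum_range_reflect fun j => U ^ μ * C v * (C (AdjoinRoot.mk T (xiCoeff g j)) * _),
      ← Finset.sum_sub_distrib]
    refine Finset.dvd_sum fun k hk => ?_
    rw [Finset.mem_range] at hk
    have h0 : X - C a ∣ (scaledCoeff g k).map (AdjoinRoot.of T) -
        C (AdjoinRoot.mk T (scaledCoeff g k) * v) * U := by
      rw [dvd_iff_isRoot, IsRoot.def, eval_sub, eval_mul, eval_C, mul_assoc, huv, mul_one, eval_map,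
        ha, ← AdjoinRoot.algebraMap_eq, ← aeval_def, AdjoinRoot.aeval_eq, sub_self]
    obtain ⟨Q, hQ⟩ := pow_dvd_derivNumIter_sub h0 k
    have hfac : (k.factorial : AdjoinRoot T) * (AdjoinRoot.mk T (scaledCoeff g k) * v) =
        AdjoinRoot.mk T (xiCoeff g (μ - 1 - k)) * v := by
      rw [scaledCoeff, ← mul_assoc, ← map_natCast (AdjoinRoot.mk T), ← map_mul, ← mul_assoc,
        ← C_eq_natCast, ← C_mul, mul_inv_cancel₀ (hμ k hk), C_1, one_mul]
    rw [hfac, C_mul] at hQ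
    have e1 : μ = (μ - 1 - k) + (k + 1) := by omega
    refine ⟨U ^ (μ - 1 - k) * Q, ?_⟩
    rw [show (X - C a) ^ μ = (X - C a) ^ (μ - 1 - k) * (X - C a) ^ (k + 1) by
        rw [← pow_add, ← e1],
      show U ^ μ = U ^ (μ - 1 - k) * U ^ (k + 1) by rw [← pow_add, ← e1], mul_pow]
    linear_combination (X - C a) ^ (μ - 1 - k) * U ^ (μ - 1 - k) * hQ
  rw [untanglingHom_mk, TruncAlg.ofCoeffs_eq]
  obtain ⟨Q, hQ⟩ := key
  rw [sub_eq_iff_eq_add] at hQ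
  rw [hQ, add_comp, map_add, mul_comp, mul_comp (U ^ μ * C v), map_mul, map_mul]
  have h1 : AdjoinRoot.mk (X ^ μ) (((X - C a) ^ μ).comp (X + C a)) = 0 := by simp
  rw [h1, zero_mul, zero_add]
  congr 1
  simp [ha, TruncAlg.xi]

/-- The indices of the element `1`. -/
def oneIndicator (F : Type u) [Field F] (d μ : ℕ) : Fin d × Fin μ → F :=
  fun p => if (p.1 : ℕ) = 0 ∧ (p.2 : ℕ) = 0 then 1 else 0

theorem xiCoeff_oneIndicator {d μ : ℕ} (hd : 0 < d) (hμ : 0 < μ) (j : ℕ) :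
    xiCoeff (oneIndicator F d μ) j = if j = 0 then 1 else 0 := by
  ext i
  unfold xiCoeff
  split_ifs with h h' h'
  · subst h'
    rw [coeff_polyOfCoeffs, ← C_1, coeff_C]
    by_cases hi : i = 0
    · simp [hi, hd, oneIndicator]
    · simp [hi, oneIndicator]
  · rw [coeff_polyOfCoeffs]
    simp [oneIndicator, h']
  · omega
  · rfl

theorem TruncAlg.ofCoeffs_oneIndicator (T : F[X]) {d μ : ℕ} (hd : 0 < d) (hμ : 0 < μ) :
    TruncAlg.ofCoeffs T (oneIndicator F d μ) = 1 := by
  rw [TruncAlg.ofCoeffs_eq, Finset.sum_eq_single 0]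
  · simp [xiCoeff_oneIndicator hd hμ]
  · intro j _ hj
    simp [xiCoeff_oneIndicator hd hμ, hj]
  · intro h
    exact absurd (Finset.mem_range.mpr hμ) h

/-- Modulo `T` only the derivative of highest order contributes, and it gives `derivative T ^ (μ -
1)`, coprime to `T` by separability. -/
theorem isCoprime_derivSum_one {T : F[X]} (hT : T.Separable) {d μ : ℕ} (hd : 0 < d) (hμ : 0 < μ)
    (hf : ∀ k < μ, (k.factorial : F) ≠ 0) :
    IsCoprime T (derivSum T μ (scaledCoeff (oneIndicator F d μ))) := by
  obtain ⟨n, rfl⟩ : ∃ n, μ = n + 1 := ⟨μ - 1, by omega⟩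
  obtain ⟨Q, hQ⟩ := dvd_derivSum_sub T n (scaledCoeff (oneIndicator F d (n + 1)))
  have h1 : (n.factorial : F[X]) * derivative T ^ n * scaledCoeff (oneIndicator F d (n + 1)) n =
      derivative T ^ n := by
    rw [scaledCoeff, xiCoeff_oneIndicator hd hμ, if_pos (by omega), mul_one, mul_right_comm,
      ← C_eq_natCast, ← C_mul, mul_inv_cancel₀ (hf n n.lt_succ_self), C_1, one_mul]
  rw [h1, sub_eq_iff_eq_add'] at hQ
  rw [hQ]
  exact (IsCoprime.pow_right hT).add_mul_left_right Q

/-- The sum attached to the element `1` untangles to `w` itself, so its inverse `V` modulo `T ^ μ`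
untangles to an inverse of `w`. -/
theorem mk_eq_tangling {T : F[X]} (hT : T.Separable) {d μ : ℕ} (hd : 0 < d) (hμ : 0 < μ)
    (hf : ∀ k < μ, (k.factorial : F) ≠ 0) (g : Fin d × Fin μ → F) {V P : F[X]}
    (hV : T ^ μ ∣ V * derivSum T μ (scaledCoeff (oneIndicator F d μ)) - 1)
    (hP : T ^ μ ∣ P - V * derivSum T μ (scaledCoeff g)) :
    AdjoinRoot.mk (T ^ μ) P = tangling T hT μ (TruncAlg.ofCoeffs T g) := by
  obtain ⟨w, hw⟩ := untanglingHom_derivSum hT hf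
  rw [tangling, AlgEquiv.eq_symm_apply]
  change untanglingHom T μ (AdjoinRoot.mk (T ^ μ) P) = TruncAlg.ofCoeffs T g
  have h1 := AdjoinRoot.mk_eq_mk.mpr hV
  have h2 := AdjoinRoot.mk_eq_mk.mpr hP
  have h3 := congrArg (untanglingHom T μ) h1
  rw [map_mul, map_mul, hw, TruncAlg.ofCoeffs_oneIndicator T hd hμ, mul_one, map_one, map_one] at h3
  rw [h2, map_mul, map_mul, hw, ← mul_assoc, h3, one_mul]

end

/-! ### Computing the sum of derivatives by divide and conquer. -/

namespace Stage

variable {F Ω : Type u} [Field F]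

/-- The powers of `T` are computed along the recursion. One level costs at most `131 * M (d * n)`: a
division (`80`), a scaling (`2`), three products of length at most `2 * d * n` (`16` each) and an
addition. -/
theorem reach_derivSum {M : ℕ → ℕ} (hM : IsMultiplicationTime F M) {d : ℕ} (hd : 0 < d) {n : ℕ}
    (hn : 0 < n) {s : Stage Ω F} {T : Ω → F[X]} {c : ℕ → Ω → F[X]} (hT : s.HasPoly (d + 1) T)
    (hT1 : ∀ ω ∈ s.inputs, (T ω).Monic) (hTd : ∀ ω ∈ s.inputs, (T ω).natDegree = d)
    (hc : ∀ k < n, s.HasPoly d (c k)) :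
    Reach (fun s' => s'.HasPoly (d * n) (fun ω => derivSum (T ω) n fun k => c k ω) ∧
      s'.HasPoly (d * n + 1) fun ω => T ω ^ n) (140 * M (d * n) * Nat.clog 2 n) s := by
  induction n using Nat.strong_induction_on generalizing s c with
  | _ n ih =>
  rcases Nat.lt_or_ge n 2 with hn2 | hn2
  · obtain rfl : n = 1 := by omega
    refine .done ⟨?_, ?_⟩
    · rw [mul_one]
      exact (hc 0 one_pos).congr fun ω _ => by simp [derivSum, derivNumIter]
    · rw [mul_one]
      exact hT.congr fun ω _ => (pow_one _).symm
  · have hclog := Nat.clog_of_two_le one_lt_two hn2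
    obtain ⟨m, e, hm, he, rfl, hme, hel⟩ : ∃ m e, 0 < m ∧ 0 < e ∧ m + e = n ∧ m ≤ e ∧
        e = (n + 2 - 1) / 2 := ⟨n / 2, (n + 2 - 1) / 2, by omega, by omega, by omega, by omega, rfl⟩
    rw [← hel] at hclog
    have hmono : Nat.clog 2 m ≤ Nat.clog 2 e := Nat.clog_mono_right 2 hme
    have hdm := Nat.mul_pos hd hm
    have hde := Nat.mul_pos hd he
    have hadd : M (d * m) + M (d * e) ≤ M (d * (m + e)) := by
      rw [mul_add]
      exact hM.add_le _ _ hdm hde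
    have hdn : d * (m + e) = d * m + d * e := mul_add ..
    have hle := hM.le_self (d * (m + e)) (by omega)
    have hem : m ≤ d * m := Nat.le_mul_of_pos_left m hd
    have h2 := hM.mulCost_two (n := d * (m + e)) (by omega)
    have hbound : 140 * M (d * m) * Nat.clog 2 m + (140 * M (d * e) * Nat.clog 2 e +
        (131 * M (d * (m + e)))) ≤ 140 * M (d * (m + e)) * Nat.clog 2 (m + e) := by
      rw [hclog]
      set l := Nat.clog 2 e
      calc 140 * M (d * m) * Nat.clog 2 m + (140 * M (d * e) * l + (131 * M (d * (m + e))))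
          ≤ 140 * M (d * m) * l + (140 * M (d * e) * l + (140 * M (d * (m + e)))) := by
            gcongr
            norm_num
        _ = 140 * (M (d * m) + M (d * e)) * l + 140 * M (d * (m + e)) := by ring
        _ ≤ 140 * M (d * (m + e)) * l + 140 * M (d * (m + e)) := by gcongr
        _ = _ := by ring
    refine (ih m (by omega) hm hT hT1 hTd fun k hk => hc k (by omega)).bind
      (m := 140 * M (d * e) * Nat.clog 2 e + 131 * M (d * (m + e))) _ hbound ?_
    rintro s₁ h₁ ⟨P₁, T₁⟩
    refine (ih e (by omega) he (c := fun k => c (m + k)) (hT.mono h₁)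
      (fun ω hω => hT1 ω (h₁.1 hω)) (fun ω hω => hTd ω (h₁.1 hω))
      fun k hk => (hc (m + k) (by omega)).mono h₁).bind (m := 131 * M (d * (m + e))) _ le_rfl ?_
    rintro s₂ h₂ ⟨P₂, T₂⟩
    have h₂' := h₁.trans h₂
    -- Precision `N` at infinity is enough, since the derivative's numerator lies over `T ^ (m +
    -- e)`, of degree `N`.
    set N := d * (m + e) with hN
    refine (reach_divMod hM (n := N) (e := d * e) (by omega) ((P₂.shift N).le (by omega))
      (T₂.le (by omega)) (by omega) (fun ω hω => (hT1 ω (h₂'.1 hω)).pow e)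
      fun ω hω => by rw [natDegree_pow, hTd ω (h₂'.1 hω), mul_comm]).bind (m := 51 * M N) _
      (by omega) ?_
    rintro s₃ h₃ ⟨Q₃, -⟩
    have Q₃' : s₃.HasPoly (2 * N) _ := Q₃.le (by omega)
    refine (s₃.reach_poly (2 * N) (fun ω => scaleIter N m ((X ^ N *
      derivSum (T ω) e fun k => c (m + k) ω) /ₘ T ω ^ e)) 1 (fun i _ s' h => ?_)
      fun ω hω i hi => ?_).bind (m := 49 * M N) _ (by omega) fun s₄ h₄ H₄ => ?_
    · refine (s'.reach_mul (s'.has_const _) ((Q₃.1 i).mono h)).mono le_rfl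
        fun _ _ H => H.congr fun ω _ => (coeff_scaleIter N m _ i).symm
    · rw [coeff_scaleIter, Q₃'.2 ω hω i hi, mul_zero]
    refine (h2.reach s₄ _ _ (((T₁.mono (h₂.trans (h₃.trans h₄)))).le (by omega))
      ((T₂.mono (h₃.trans h₄)).le (by omega))).bind (m := 33 * M N) _ (by omega)
      fun s₅ h₅ H₅ => ?_
    have h₅' := h₂'.trans (h₃.trans (h₄.trans h₅))
    have hTc : ∀ ω ∈ s.inputs, ∀ i, d + 1 ≤ i → (T ω).coeff i = 0 := hT.2
    have T₅ : s₅.HasPoly (N + 1) fun ω => T ω ^ (m + e) :=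
      (H₅.congr fun ω _ => (pow_add _ _ _).symm).of_degree fun ω hω =>
        coeff_pow_eq_zero (hTc ω (h₅'.1 hω)) (m + e)
    refine (h2.reach s₅ _ _ (H₄.mono h₅) (T₅.le (by omega))).bind (m := 17 * M N) _ (by omega)
      fun s₆ h₆ H₆ => ?_
    have R₆ : s₆.HasPoly N fun ω => derivNumIter (T ω) e m
        (derivSum (T ω) e fun k => c (m + k) ω) := by
      refine ((H₆.highPart (N + m)).congr fun ω hω => ?_).of_degree fun ω hω i hi => ?_
      · have hω' := (h₅'.trans h₆).1 hω
        rw [derivNumIter_eq_highPart (d := d) (N := N) (hT1 ω hω') (hTd ω hω')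
          (by rw [hN, add_comm m e]; omega), add_comm e m]
      · have hω' := (h₅'.trans h₆).1 hω
        exact coeff_derivNumIter (hTc ω hω') (P₂.2 ω ((h₃.trans (h₄.trans (h₅.trans h₆))).1 hω))
          m i (by rw [add_comm e m]; exact hi)
    have h₂₆ := h₃.trans (h₄.trans (h₅.trans h₆))
    refine (h2.reach s₆ _ _ ((T₂.mono h₂₆).le (by omega))
      ((P₁.mono (h₂.trans h₂₆)).le (by omega))).bind (m := M N) _ (by omega) fun s₇ h₇ H₇ => ?_
    have h₇' := h₂'.trans (h₂₆.trans h₇)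
    have H₇' := H₇.of_degree (m := N) fun ω hω i hi =>
      coeff_mul_eq_zero_of_le (coeff_pow_eq_zero (hTc ω (h₇'.1 hω)) e)
        (P₁.2 ω ((h₂.trans (h₂₆.trans h₇)).1 hω)) i (by omega)
    refine (reach_poly_add H₇' (R₆.mono h₇)).mono hle fun s₈ h₈ H₈ =>
      ⟨H₈.congr fun ω _ => ?_, T₅.mono (h₆.trans (h₇.trans h₈))⟩
    rw [derivSum_add]

end Stage

/-! ### The tangling algorithm -/

/-- Newton iteration modulo powers of `T`: up to multiples of `T ^ μ`, `V' * A - 1` is `-(V * A - 1)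
^ 2`. -/
theorem pow_dvd_lift {F : Type u} [Field F] {T V V' W A : F[X]} {j k μ : ℕ}
    (hV : T ^ j ∣ V * A - 1) (hk : k ≤ 2 * j) (hkμ : k ≤ μ) (hW : T ^ μ ∣ W - V * A)
    (hV' : T ^ μ ∣ V' - V * (2 - W)) : T ^ k ∣ V' * A - 1 := by
  obtain ⟨a, ha⟩ := (pow_dvd_pow T hkμ).trans hW
  obtain ⟨b, hb⟩ := (pow_dvd_pow T hkμ).trans hV'
  have h3 : T ^ k ∣ (V * A - 1) * (V * A - 1) := by
    refine (pow_dvd_pow T hk).trans ?_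
    rw [two_mul, pow_add]
    exact mul_dvd_mul hV hV
  obtain ⟨c, hc⟩ := h3
  exact ⟨b * A - V * A * a - c, by linear_combination A * hb - V * A * ha - hc⟩

theorem factorial_cast_ne_zero {F : Type u} [Field F] {μ : ℕ}
    (h : ringChar F = 0 ∨ μ ≤ ringChar F) : ∀ k < μ, (k.factorial : F) ≠ 0 := by
  intro k hk h0
  rw [ringChar.spec] at h0
  rcases h with h | h
  · rw [h, zero_dvd_iff] at h0
    exact k.factorial_ne_zero h0
  · rcases CharP.char_is_prime_or_zero F (ringChar F) with hp | hp
    · have := (hp.dvd_factorial).mp h0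
      omega
    · omega

theorem coeff_xiCoeff {F : Type u} [Field F] {d μ : ℕ} (g : Fin d × Fin μ → F) (j i : ℕ) :
    (xiCoeff g j).coeff i = if h : i < d ∧ j < μ then g (⟨i, h.1⟩, ⟨j, h.2⟩) else 0 := by
  unfold xiCoeff
  by_cases hj : j < μ
  · by_cases hi : i < d <;> simp [coeff_polyOfCoeffs, hi, hj]
  · simp [hj]

namespace Stage

variable {F Ω : Type u} [Field F]

/-- Every step works modulo the full power `T ^ μ`; the allowed factor `log μ` makes it unnecessary
to form the intermediate powers. -/
theorem reach_lift {M : ℕ → ℕ} (hM : IsMultiplicationTime F M) {n : ℕ} (hn : 0 < n) {μ : ℕ}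
    {s : Stage Ω F} {T A V : Ω → F[X]} (hT : s.HasPoly (n + 1) fun ω => T ω ^ μ)
    (hT1 : ∀ ω ∈ s.inputs, (T ω).Monic) (hTn : ∀ ω ∈ s.inputs, (T ω ^ μ).natDegree = n)
    (hA : s.HasPoly n A) (hV : s.HasPoly n V) (h : ∀ ω ∈ s.inputs, T ω ∣ V ω * A ω - 1) (i : ℕ) :
    Reach (fun s' => ∃ V', s'.HasPoly n V' ∧ ∀ ω ∈ s'.inputs, ∀ k, k ≤ 2 ^ i → k ≤ μ →
      T ω ^ k ∣ V' ω * A ω - 1) (163 * M n * i) s := by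
  have hle := hM.le_self n hn
  induction i with
  | zero =>
    refine .done ⟨V, hV, fun ω hω k hk _ => (pow_dvd_pow _ hk).trans ?_⟩
    rw [pow_zero, pow_one]
    exact h ω hω
  | succ i ih =>
    refine ih.bind (m := 163 * M n) _ (by rw [mul_add, mul_one]) ?_
    rintro s₁ h₁ ⟨V, hV, H₁⟩
    have hmul := hM.mulCost hn
    refine (hmul.reach s₁ V A hV (hA.mono h₁)).bind (m := 162 * M n) _ (by omega)
      fun s₂ h₂ H₂ => ?_
    have h₂' := h₁.trans h₂
    refine (reach_divMod hM hn H₂ ((hT.mono h₂').le (by omega)) (by omega)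
      (fun ω hω => (hT1 ω (h₂'.1 hω)).pow μ) fun ω hω => hTn ω (h₂'.1 hω)).bind
      (m := 82 * M n) _ (by omega) ?_
    rintro s₃ h₃ ⟨-, H₃⟩
    have two : s₃.HasPoly n fun _ => (2 : F[X]) := s₃.hasPoly_const 2 fun i hi => by
      rw [← C_ofNat, coeff_C, if_neg (by omega)]
    refine (reach_poly_sub two H₃).bind (m := 81 * M n) _ (by omega) fun s₄ h₄ H₄ => ?_
    refine (hmul.reach s₄ _ _ (hV.mono (h₂.trans (h₃.trans h₄))) H₄).bind (m := 80 * M n) _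
      (by omega) fun s₅ h₅ H₅ => ?_
    have h₅' := h₂'.trans (h₃.trans (h₄.trans h₅))
    refine (reach_divMod hM hn H₅ ((hT.mono h₅').le (by omega)) (by omega)
      (fun ω hω => (hT1 ω (h₅'.1 hω)).pow μ) fun ω hω => hTn ω (h₅'.1 hω)).mono le_rfl ?_
    rintro s₆ h₆ ⟨-, H₆⟩
    refine ⟨_, H₆, fun ω hω k hk hkμ => ?_⟩
    have hω' := (h₂.trans (h₃.trans (h₄.trans (h₅.trans h₆)))).1 hω
    -- The precision already reached is `2 ^ i`, capped at `μ`.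
    refine pow_dvd_lift (H₁ ω hω' (min (2 ^ i) μ) (min_le_left _ _) (min_le_right _ _))
      (by rw [pow_succ] at hk; omega) hkμ (dvd_modByMonic_sub _ _) (dvd_modByMonic_sub _ _)

theorem reach_tangling {M : ℕ → ℕ} (hM : IsMultiplicationTime F M) {d μ : ℕ} (hd : 0 < d)
    (hμ : 2 ≤ μ) (hf : ∀ k < μ, (k.factorial : F) ≠ 0) {s : Stage Ω F} {T : Ω → F[X]}
    {g : Ω → Fin d × Fin μ → F} (hT : s.HasPoly (d + 1) T) (hT1 : ∀ ω ∈ s.inputs, (T ω).Monic)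
    (hTd : ∀ ω ∈ s.inputs, (T ω).natDegree = d) (hTs : ∀ ω ∈ s.inputs, (T ω).Separable)
    (hg : ∀ p, s.Has fun ω => g ω p) :
    Reach (fun s' => ∃ V P : Ω → F[X], s'.HasPoly (d * μ) P ∧ ∀ ω ∈ s'.inputs,
      T ω ^ μ ∣ V ω * derivSum (T ω) μ (scaledCoeff (oneIndicator F d μ)) - 1 ∧
      T ω ^ μ ∣ P ω - V ω * derivSum (T ω) μ (scaledCoeff (g ω)))
      (700 * M (d * μ) * Nat.clog 2 μ + 1542 * M d * (Nat.clog 2 d + 1)) s := by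
  have hn : 0 < d * μ := Nat.mul_pos hd (by omega)
  have hdn : 2 * d ≤ d * μ := by rw [mul_comm]; exact Nat.mul_le_mul_left d hμ
  have hle := hM.le_self _ hn
  have hL : 1 ≤ Nat.clog 2 μ := Nat.clog_pos one_lt_two hμ
  have hL' : 2 * M (d * μ) * Nat.clog 2 μ ≥ 2 * M (d * μ) := Nat.le_mul_of_pos_right _ hL
  set L := Nat.clog 2 μ
  set n := d * μ with hn_def
  have hmul := hM.mulCost hn
  set K := 1542 * M d * (Nat.clog 2 d + 1)
  have hassoc : ∀ c, c * M n * L = c * (M n * L) := fun c => mul_assoc ..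
  simp only [hassoc] at hL' ⊢
  have hscaled : ∀ (g : Fin d × Fin μ → F) (k i : ℕ), d ≤ i → (scaledCoeff g k).coeff i = 0 := by
    intro g k i hi
    rw [scaledCoeff, coeff_C_mul, coeff_xiCoeff, dif_neg (by omega), mul_zero]
  have hxi : ∀ j, s.HasPoly d fun ω => xiCoeff (g ω) j := by
    refine fun j => ⟨fun i => ?_, fun ω _ i hi => by rw [coeff_xiCoeff, dif_neg (by omega)]⟩
    simp only [coeff_xiCoeff]
    split_ifs with h
    · exact hg _
    · exact s.has_const 0
  refine (s.reach_forall d (fun k s' => s'.HasPoly d fun ω => scaledCoeff (g ω) k)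
    (fun _ _ _ hs h => h.mono hs) μ fun k _ s' h =>
      reach_poly_C_mul (s'.has_const _) ((hxi _).mono h)).bind
    (m := 443 * (M n * L) + 241 * M n + K) _ (by rw [mul_comm μ d, ← hn_def]; omega)
    fun s₁ h₁ H₁ => ?_
  refine (reach_derivSum hM hd (n := μ) (c := fun k ω => scaledCoeff (g ω) k) (by omega)
    (hT.mono h₁) (fun ω hω => hT1 ω (h₁.1 hω)) (fun ω hω => hTd ω (h₁.1 hω)) H₁).bind
    (m := 303 * (M n * L) + 241 * M n + K) _ (by rw [hassoc]; omega) ?_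
  rintro s₂ h₂ ⟨G₂, -⟩
  have h₂' := h₁.trans h₂
  refine (reach_derivSum hM hd (n := μ) (c := fun k _ => scaledCoeff (oneIndicator F d μ) k)
    (by omega) (hT.mono h₂') (fun ω hω => hT1 ω (h₂'.1 hω)) (fun ω hω => hTd ω (h₂'.1 hω))
    fun k _ => s₂.hasPoly_const _ (hscaled _ k)).bind
    (m := 163 * (M n * L) + 241 * M n + K) _ (by rw [hassoc]; omega) ?_
  rintro s₃ h₃ ⟨A₃, T₃⟩
  have h₃' := h₂'.trans h₃
  have hTn : ∀ ω ∈ s.inputs, (T ω ^ μ).natDegree = n := fun ω hω => by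
    rw [natDegree_pow, hTd ω hω, mul_comm]
  -- Reducing modulo `T` before inverting keeps the gcd at degree `d`, hence the term in `M d * log
  -- d`.
  refine (reach_divMod hM hn (A₃.le (by omega)) ((hT.mono h₃').le (by omega)) (by omega)
    (fun ω hω => hT1 ω (h₃'.1 hω)) fun ω hω => hTd ω (h₃'.1 hω)).bind
    (m := 163 * (M n * L) + 161 * M n + K) _ (by omega) ?_
  rintro s₄ h₄ ⟨-, A₄⟩
  have h₄' := h₃'.trans h₄
  refine (reach_inverse_mod hM hd (hT.mono h₄') A₄ (fun ω hω => hT1 ω (h₄'.1 hω))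
    (fun ω hω => hTd ω (h₄'.1 hω)) fun ω hω => ?_).bind
    (m := 163 * (M n * L) + 161 * M n) _ (by omega) ?_
  · obtain ⟨q, hq⟩ := dvd_modByMonic_sub
      (derivSum (T ω) μ (scaledCoeff (oneIndicator F d μ))) (T ω)
    rw [sub_eq_iff_eq_add'] at hq
    rw [hq]
    exact (isCoprime_derivSum_one (hTs ω (h₄'.1 hω)) hd (by omega) hf).add_mul_left_right q
  rintro s₅ h₅ ⟨V₅, H₅, hV₅⟩
  have h₅' := h₄'.trans h₅
  -- The inverse has up to `d + 2` coefficients, more than `n` when `d = 1` and `μ = 2`, so it is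
  -- reduced modulo `T ^ μ`.
  refine (reach_divMod hM hn (A := V₅) (H₅.le (by omega))
    ((T₃.mono (h₄.trans h₅)).le (by omega)) (e := n) (by omega)
    (fun ω hω => (hT1 ω (h₅'.1 hω)).pow μ) fun ω hω => hTn ω (h₅'.1 hω)).bind
    (m := 163 * (M n * L) + 81 * M n) _ (by omega) ?_
  rintro s₆ h₆ ⟨-, V₆⟩
  have h₆' := h₅'.trans h₆
  refine (reach_lift hM hn (T₃.mono (h₄.trans (h₅.trans h₆))) (fun ω hω => hT1 ω (h₆'.1 hω))
    (fun ω hω => hTn ω (h₆'.1 hω)) (A₃.mono (h₄.trans (h₅.trans h₆))) V₆ (fun ω hω => ?_) L).bind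
    (m := 81 * M n) _ (by rw [hassoc]) ?_
  · obtain ⟨a, ha⟩ := hV₅ ω (h₆.1 hω)
    obtain ⟨b, hb⟩ := (dvd_pow_self (T ω) (show μ ≠ 0 by omega)).trans
      (dvd_modByMonic_sub (V₅ ω) (T ω ^ μ))
    obtain ⟨c, hc⟩ := dvd_modByMonic_sub
      (derivSum (T ω) μ (scaledCoeff (oneIndicator F d μ))) (T ω)
    refine ⟨a + b * derivSum (T ω) μ (scaledCoeff (oneIndicator F d μ)) - V₅ ω * c, ?_⟩
    linear_combination ha + derivSum (T ω) μ (scaledCoeff (oneIndicator F d μ)) * hb - V₅ ω * hc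
  rintro s₇ h₇ ⟨V₇, H₇, hV₇⟩
  refine (hmul.reach s₇ _ _ H₇ (G₂.mono (h₃.trans (h₄.trans (h₅.trans (h₆.trans h₇)))))).bind
    (m := 80 * M n) _ (by omega) fun s₈ h₈ H₈ => ?_
  have h₈' := h₆'.trans (h₇.trans h₈)
  refine (reach_divMod hM hn H₈
    ((T₃.mono (h₄.trans (h₅.trans (h₆.trans (h₇.trans h₈))))).le (by omega)) (e := n) (by omega)
    (fun ω hω => (hT1 ω (h₈'.1 hω)).pow μ) fun ω hω => hTn ω (h₈'.1 hω)).mono le_rfl ?_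
  rintro s₉ h₉ ⟨-, H₉⟩
  exact ⟨V₇, _, H₉, fun ω hω =>
    ⟨hV₇ ω ((h₈.trans h₉).1 hω) μ (Nat.le_pow_clog one_lt_two μ) le_rfl,
      dvd_modByMonic_sub _ _⟩⟩

end Stage

/-! ### Real logarithms, degenerate cases and conclusion. -/

theorem clog_two_le_log {n : ℕ} (hn : 2 ≤ n) : (Nat.clog 2 n : ℝ) ≤ 3 * Real.log n := by
  have h1 : 2 ^ (Nat.clog 2 n - 1) ≤ n := (Nat.pow_pred_clog_lt_self one_lt_two hn).le
  have hL : 1 ≤ Nat.clog 2 n := Nat.clog_pos one_lt_two hn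
  have h2 : ((Nat.clog 2 n : ℝ) - 1) * Real.log 2 ≤ Real.log n := by
    have : (2 : ℝ) ^ (Nat.clog 2 n - 1) ≤ n := by exact_mod_cast h1
    have := Real.log_le_log (by positivity) this
    rwa [Real.log_pow, Nat.cast_sub hL, Nat.cast_one] at this
  have h3 : Real.log 2 ≤ Real.log n := Real.log_le_log two_pos (by exact_mod_cast hn)
  have h4 := Real.log_two_gt_d9
  have h5 : (0 : ℝ) ≤ Nat.clog 2 n := Nat.cast_nonneg _
  -- The ceiling is at most `log n / log 2 + 1 ≤ (2 / log 2) * log n`, and `2 / log 2 < 3`.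
  nlinarith

theorem cost_bound {m k d μ : ℕ} (hd : 0 < d) (hμ : 2 ≤ μ) (hk : k ≤ m) :
    ((700 * m * Nat.clog 2 μ + 1542 * k * (Nat.clog 2 d + 1) : ℕ) : ℝ) ≤
      10000 * (m * Real.log μ + k * Real.log d) := by
  have h1 := clog_two_le_log hμ
  have hm : (0 : ℝ) ≤ m := Nat.cast_nonneg m
  have hk0 : (0 : ℝ) ≤ k := Nat.cast_nonneg k
  have hkm : (k : ℝ) ≤ m := by exact_mod_cast hk
  have h2 := Real.log_two_gt_d9
  have h3 : Real.log 2 ≤ Real.log μ := Real.log_le_log two_pos (by exact_mod_cast hμ)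
  have h4 : (m : ℝ) * Nat.clog 2 μ ≤ m * (3 * Real.log μ) := by gcongr
  push_cast
  rcases Nat.lt_or_ge d 2 with hd2 | hd2
  -- Here `log d = 0`, and the cost of inverting modulo `T` is absorbed by the first term, as `k ≤
  -- m` and `log μ > 1 / 2`.
  · obtain rfl : d = 1 := by omega
    have h5 : (m : ℝ) * 0.5 ≤ m * Real.log μ := by
      gcongr
      linarith
    simp only [Nat.clog_one_right, Nat.cast_zero, Nat.cast_one, Real.log_one]
    linarith
  · have h5 := clog_two_le_log hd2
    have h6 : Real.log 2 ≤ Real.log d := Real.log_le_log two_pos (by exact_mod_cast hd2)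
    have h7 : (k : ℝ) * (Nat.clog 2 d + 1) ≤ k * (5 * Real.log d) := by
      gcongr
      linarith
    have h8 : 0 ≤ (m : ℝ) * Real.log μ := mul_nonneg hm (by linarith)
    have h9 : 0 ≤ (k : ℝ) * Real.log d := mul_nonneg hk0 (by linarith)
    linarith

theorem tangling_of_natDegree_eq_zero {F : Type u} [Field F] {T : F[X]} (hT : T.Separable)
    (hT1 : T.Monic) (hT0 : T.natDegree = 0) (μ : ℕ) (P : F[X]) (x : TruncAlg T μ) :
    AdjoinRoot.mk (T ^ μ) P = tangling T hT μ x := by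
  obtain ⟨Q, hQ⟩ := AdjoinRoot.mk_surjective (tangling T hT μ x)
  rw [← hQ, AdjoinRoot.mk_eq_mk, hT1.natDegree_eq_zero.mp hT0, one_pow]
  exact one_dvd _

/-- For `μ = 1` the class `ξ` is zero and untangling is `x ↦ α`, so coefficients are merely copied.
-/
theorem tangling_of_one {F : Type u} [Field F] {T : F[X]} (hT : T.Separable) {d : ℕ}
    (g : Fin d × Fin 1 → F) :
    AdjoinRoot.mk (T ^ 1) (xiCoeff g 0) = tangling T hT 1 (TruncAlg.ofCoeffs T g) := by
  rw [tangling, AlgEquiv.eq_symm_apply]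
  change untanglingHom T 1 (AdjoinRoot.mk (T ^ 1) (xiCoeff g 0)) = TruncAlg.ofCoeffs T g
  have hxi : TruncAlg.xi T 1 = 0 := by
    rw [TruncAlg.xi, ← AdjoinRoot.mk_X, AdjoinRoot.mk_eq_zero, pow_one]
  rw [untanglingHom_mk, ← TruncAlg.aeval_xi_add_alpha, hxi, zero_add, TruncAlg.ofCoeffs_eq,
    Finset.sum_range_one, pow_zero, mul_one, TruncAlg.alpha, aeval_def,
    ← AdjoinRoot.aeval_eq, aeval_def, hom_eval₂]
  rfl

theorem proposition1 :
    ∃ c : ℝ, ∀ (F : Type u) [Field F] (M : ℕ → ℕ), IsMultiplicationTime F M →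
      ∀ d μ : ℕ, 0 < μ → (ringChar F = 0 ∨ μ ≤ ringChar F) →
        ∃ P : CompTree F (Fin (d * μ)) (Fin d ⊕ Fin d × Fin μ),
          ∀ (T : F[X]) (hT : T.Separable), T.Monic → T.natDegree = d →
            ∀ g : Fin d × Fin μ → F, ∃ f : Fin (d * μ) → F,
              P.Computes (Sum.elim (fun i => T.coeff i) g) f
                (c * (M (d * μ) * Real.log μ + M d * Real.log d)) ∧
              AdjoinRoot.mk (T ^ μ) (polyOfCoeffs f) =
                tangling T hT μ (TruncAlg.ofCoeffs T g) := by
  refine ⟨10000, fun F _ M hM d μ hμ hchar => ?_⟩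
  have hbound : (0 : ℝ) ≤ 10000 * (M (d * μ) * Real.log μ + M d * Real.log d) := by
    have := Real.log_natCast_nonneg μ
    have := Real.log_natCast_nonneg d
    positivity
  rcases Nat.eq_zero_or_pos d with rfl | hd
  · refine ⟨.ret fun i => absurd i.2 (by simp), fun T hT hT1 hT0 g => ⟨_, ⟨0, rfl, ?_⟩,
      tangling_of_natDegree_eq_zero hT hT1 hT0 μ _ _⟩⟩
    exact_mod_cast hbound
  -- For `μ = 1` the first term of the bound vanishes, and for `d = 1` the second too, so the tree
  -- must use no operation.
  rcases Nat.lt_or_ge μ 2 with hμ2 | hμ2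
  · obtain rfl : μ = 1 := by omega
    refine ⟨.ret fun i => .inr (Fin.cast (mul_one d) i, 0), fun T hT _ _ g =>
      ⟨_, ⟨0, rfl, by exact_mod_cast hbound⟩, ?_⟩⟩
    rw [← tangling_of_one]
    congr 1
    ext i
    rw [coeff_polyOfCoeffs, coeff_xiCoeff]
    by_cases hi : i < d
    · rw [dif_pos (by omega), dif_pos ⟨hi, one_pos⟩]
      rfl
    · rw [dif_neg (by omega), dif_neg (by omega)]
  let Ω := {T : F[X] // T.Separable ∧ T.Monic ∧ T.natDegree = d} × (Fin d × Fin μ → F)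
  let ρ : Fin d ⊕ Fin d × Fin μ → Ω → F := fun v ω =>
    Sum.elim (fun i : Fin d => ω.1.1.coeff i) ω.2 v
  let s : Stage Ω F := ⟨Set.univ, Set.range ρ⟩
  have hs : ∀ v, s.Has (ρ v) := fun v => .inl ⟨_, ⟨v, rfl⟩, fun _ _ => rfl⟩
  have hT : s.HasPoly (d + 1) fun ω => ω.1.1 := by
    refine Stage.hasPoly_of_lt (fun i hi => ?_) fun ω _ i hi =>
      coeff_eq_zero_of_natDegree_lt (by rw [ω.1.2.2.2]; omega)
    rcases Nat.lt_succ_iff_lt_or_eq.mp hi with hi | rfl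
    · exact hs (.inl ⟨i, hi⟩)
    -- The leading coefficient is not an input; monicity makes it the free constant `1`.
    · refine (s.has_const 1).congr fun ω _ => ?_
      have := ω.1.2.2.1.coeff_natDegree
      rw [ω.1.2.2.2] at this
      exact this.symm
  have hreach := Stage.reach_tangling hM hd hμ2 (factorial_cast_ne_zero hchar) hT
    (fun ω _ => ω.1.2.2.1) (fun ω _ => ω.1.2.2.2) (fun ω _ => ω.1.2.1)
    (g := fun ω => ω.2) fun p => hs (.inr p)
  let Y : Ω → (Fin (d * μ) → F) → Prop := fun ω y =>
    AdjoinRoot.mk (ω.1.1 ^ μ) (polyOfCoeffs y) =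
      tangling ω.1.1 ω.1.2.1 μ (TruncAlg.ofCoeffs ω.1.1 ω.2)
  obtain ⟨t, ht⟩ := Stage.exists_compTree_of_reach Y
    (Q := fun s => ∃ out : Fin (d * μ) → Ω → F, (∀ i, out i ∈ s.known) ∧
      ∀ ω ∈ s.inputs, Y ω fun i => out i ω) (fun _ h => h)
    (hreach.bind (m := 0) _ le_rfl fun s' _ ⟨V, P, hP, h⟩ =>
      Stage.Reach.ofKnown_family (fun i ω => (P ω).coeff i) (fun i => hP.1 i)
        fun s'' _ he a ha haa => .done ⟨a, ha, fun ω hω => by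
          rw [he] at hω
          have e : (fun i => a i ω) = fun i : Fin (d * μ) => (P ω).coeff i :=
            funext fun i => haa ω hω i
          simp only [Y, e]
          rw [polyOfCoeffs_coeff (hP.2 ω hω)]
          exact mk_eq_tangling ω.1.2.1 hd hμ (factorial_cast_ne_zero hchar) ω.2 (h ω hω).1
            (h ω hω).2⟩) ρ fun a ha => ha
  refine ⟨t, fun T hT hT1 hTd g => ?_⟩
  obtain ⟨y, k, h1, h2, h3⟩ := ht (⟨T, hT, hT1, hTd⟩, g) (Set.mem_univ _)
  refine ⟨y, ⟨k, h1, ?_⟩, h3⟩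
  refine le_trans (by exact_mod_cast h2) (cost_bound hd hμ2 (hM.mono hd ?_))
  exact Nat.le_mul_of_pos_right d hμ
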